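/- **Setting.** A *labelled tree* is a pair $(V,E)$ of a finite nonempty set $V\subset\mathbb Z$ and $E\subset\{(x,y)\in V\times V: x<y\}$ such that every vertex has at most one incoming edge and, for distinct $x,y\in V$, there is a path from $x$ to $y$, or from $y$ to $x$, or from some third vertex $z$ to both. Two labelled trees are isomorphic if a bijection of their vertex sets preserves and reflects edges; $T$ is the set of isomorphism classes. For $t\in T$, $r(t)$ is the number of vertices and $T_{\le m}=\{t\in T: r(t)\le m\}$; $\alpha(t)$ is the number of labelled trees that are isomorphic to a fixed labelled representative of $t$ and have the same vertex set as it. We write $t=[t_1\cdots t_l]$, $l\ge 0$, if $t_1,\dots,t_l\in T$ are the subtrees hanging at the children of the root of $t$ (up to order, with multiplicity); $l=0$ gives the one-vertex tree $\tau$. For a real $K\times K$ matrix $A=(a_{ij})$, $W:\mathbb R^N\to\mathbb R^N$ smooth and $t=[t_1\cdots t_l]$ put, with empty products equal to $1$, $$\zeta_i(t;A)=\sum_{j=1}^K a_{ij}\prod_{k=1}^l\zeta_j(t_k;A),\qquad D(W,t)(x)=W^{(l)}(x)\bigl(D(W,t_1)(x),\dots,D(W,t_l)(x)\bigr),$$ and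 $\sigma(t)=\prod_i m_i!\,\sigma(u_i)^{m_i}$ if $u_1,u_2,\dots$ are the distinct trees among $t_1,\dots,t_l$ and $m_i$ are their multiplicities (so $D(W,\tau)=W$, $\sigma(\tau)=1$, $\zeta_i(\tau;A)=\sum_j a_{ij}$). Let $C_b^\infty(\mathbb R^N;\mathbb R^N)$ be the set of smooth maps that are bounded together with all their derivatives, and $\|W\|_{C^n}=\sum_{i=0}^n\|W^{(i)}\|$ with $\|W^{(i)}\|=\sup\{|W^{(i)}(x)(U_1,\dots,U_i)|: x\in\mathbb R^N,\ |U_1|=\dots=|U_i|=1\}$. For $V\in C_b^\infty$, $\exp(V)(x)$ is the value at time $1$ of the solution of $\dot z=V(z)$, $z(0)=x$; thus $\exp(sW)(y_0)=y(s)$ where $\dot y=W(y)$, $y(0)=y_0$. **Theorem.** Let $m\ge 0$ be an integer. (1) There is a constant $C>0$, depending only on $m$, such that for all $N\ge 0$, $W\in C_b^\infty(\mathbb R^N;\mathbb R^N)$, $y_0\in\mathbb R^N$ and $s\ge 0$, $$\Bigl|\exp(sW)(y_0)-\Bigl(y_0+\sum_{t\in T_{\le m}}\frac{s^{r(t)}}{r(t)!}\,\alpha(t)\,D(W,t)(y_0)\Bigr)\Bigr|\le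 C\,s^{m+1}\,\|W\|_{C^{m+1}}^{m+1}.$$ (2) Let $K\ge 0$, $A=(a_{ij})\in\mathbb R^{K\times K}$ and $b\in\mathbb R^K$. There is a constant $C'>0$, depending only on $m$, $K$, $A$ and $b$, such that for all $N\ge 0$, $W\in C_b^\infty(\mathbb R^N;\mathbb R^N)$, $y_0\in\mathbb R^N$, $s\ge 0$ and all $Y_1,\dots,Y_K\in\mathbb R^N$ that satisfy the Runge–Kutta stage equations $Y_i=y_0+s\sum_{j=1}^K a_{ij}W(Y_j)$ $(i=1,\dots,K)$, the Runge–Kutta output $Y(y_0;W,s)=y_0+s\sum_{i=1}^K b_iW(Y_i)$ satisfies $$\Bigl|Y(y_0;W,s)-\Bigl(y_0+\sum_{t=[t_1\cdots t_l]\in T_{\le m},\ l\ge 0}\frac{s^{r(t)}}{\sigma(t)}\sum_{i=1}^K b_i\prod_{k=1}^l\zeta_i(t_k;A)\,D(W,t)(y_0)\Bigr)\Bigr|\le C'\,s^{m+1}\,\|W\|_{C^{m+1}}^{m+1}.$$ -/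

import Mathlib

noncomputable section

namespace RKTree

/-! ### Labelled and non-labelled rooted trees -/

/-- A labelled (rooted, increasing) tree: a finite nonempty vertex set of integers, edges pointing
from smaller to larger labels, at most one incoming edge at each vertex, and the connectedness
condition. A path from `x` to `y` is a nonempty chain of edges, i.e. the transitive closure of the
edge relation. -/
@[ext] structure LTree where
  V : Finset ℤ
  E : Finset (ℤ × ℤ)
  nonempty : V.Nonempty
  edge_mem : ∀ x y, (x, y) ∈ E → x ∈ V ∧ y ∈ V ∧ x < y
  parent_unique : ∀ x x' y, (x, y) ∈ E → (x', y) ∈ E → x = x'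
  connected : ∀ x ∈ V, ∀ y ∈ V, x ≠ y →
    Relation.TransGen (fun a b => (a, b) ∈ E) x y ∨
    Relation.TransGen (fun a b => (a, b) ∈ E) y x ∨
    ∃ z ∈ V, z ≠ x ∧ z ≠ y ∧ Relation.TransGen (fun a b => (a, b) ∈ E) z x ∧
      Relation.TransGen (fun a b => (a, b) ∈ E) z y

namespace LTree

/-- There is a path from `x` to `y`. -/
def Path (u : LTree) (x y : ℤ) : Prop := Relation.TransGen (fun a b => (a, b) ∈ u.E) x y

theorem Path.lt {u : LTree} {x y : ℤ} (h : u.Path x y) : x < y := by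
  induction h with
  | single h => exact (u.edge_mem _ _ h).2.2
  | tail _ h ih => exact ih.trans (u.edge_mem _ _ h).2.2

theorem Path.mem_left {u : LTree} {x y : ℤ} (h : u.Path x y) : x ∈ u.V := by
  induction h with
  | single h => exact (u.edge_mem _ _ h).1
  | tail _ _ ih => exact ih

theorem Path.mem_right {u : LTree} {x y : ℤ} (h : u.Path x y) : y ∈ u.V := by
  cases h with
  | single h => exact (u.edge_mem _ _ h).2.1
  | tail _ h => exact (u.edge_mem _ _ h).2.1

/-- The root; since edges increase labels it is the smallest vertex. See `path_root` and
`root_unique` for the characterization of the root by paths. -/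
def root (u : LTree) : u.V := ⟨u.V.min' u.nonempty, u.V.min'_mem u.nonempty⟩

theorem root_le (u : LTree) {x : ℤ} (hx : x ∈ u.V) : (u.root : ℤ) ≤ x := u.V.min'_le x hx

theorem path_root (u : LTree) {x : ℤ} (hx : x ∈ u.V) (hne : x ≠ u.root) : u.Path u.root x := by
  rcases u.connected _ u.root.2 x hx hne.symm with h | h | ⟨z, hz, _, _, h, _⟩
  · exact h
  · exact absurd (Path.lt h) (not_lt.2 (u.root_le hx))
  · exact absurd (Path.lt h) (not_lt.2 (u.root_le hz))

theorem root_unique (u : LTree) (r : u.V) (hr : ∀ x ∈ u.V, x ≠ r → u.Path r x) : r = u.root := by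
  by_contra hne
  have h := hr u.root u.root.2 (fun h => hne (Subtype.ext h.symm))
  exact absurd h.lt (not_lt.2 (u.root_le r.2))

/-- Isomorphism of labelled trees: a bijection of the vertex sets preserving and reflecting
edges (labels are not required to be preserved in order). -/
def Iso (u v : LTree) : Prop :=
  ∃ φ : u.V ≃ v.V, ∀ x y : u.V, ((x : ℤ), (y : ℤ)) ∈ u.E ↔ ((φ x : ℤ), (φ y : ℤ)) ∈ v.E

theorem Iso.refl (u : LTree) : Iso u u := ⟨Equiv.refl _, fun _ _ => Iff.rfl⟩

theorem Iso.symm {u v : LTree} : Iso u v → Iso v u := by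
  rintro ⟨φ, h⟩
  exact ⟨φ.symm, fun x y => by simpa using (h (φ.symm x) (φ.symm y)).symm⟩

theorem Iso.trans {u v w : LTree} : Iso u v → Iso v w → Iso u w := by
  rintro ⟨φ, h⟩ ⟨ψ, k⟩
  exact ⟨φ.trans ψ, fun x y => (h x y).trans (k _ _)⟩

instance setoid : Setoid LTree := ⟨Iso, Iso.refl, Iso.symm, Iso.trans⟩

/-- Equivalence of labelled trees: isomorphic trees on the same vertex set. -/
def Equivalent (u v : LTree) : Prop := u.V = v.V ∧ Iso u v

/-- The children of the vertex `x`. -/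
def children (u : LTree) (x : u.V) : Finset u.V :=
  Finset.univ.filter fun c => ((x : ℤ), (c : ℤ)) ∈ u.E

open Classical in
/-- The subtree of `u` hanging at the vertex `x`: `x` and all vertices reached from `x` by a
path, with the edges of `u` between them. -/
def subtree (u : LTree) (x : u.V) : LTree where
  V := u.V.filter fun y : ℤ => y = (x : ℤ) ∨ u.Path x y
  E := u.E.filter fun e : ℤ × ℤ => (e.1 = (x : ℤ) ∨ u.Path x e.1) ∧ (e.2 = (x : ℤ) ∨ u.Path x e.2)
  nonempty := ⟨x, by simp⟩
  edge_mem := by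
    intro a b h
    simp only [Finset.mem_filter] at h ⊢
    have := u.edge_mem a b h.1
    exact ⟨⟨this.1, h.2.1⟩, ⟨this.2.1, h.2.2⟩, this.2.2⟩
  parent_unique := by
    intro a a' b h h'
    simp only [Finset.mem_filter] at h h'
    exact u.parent_unique a a' b h.1 h'.1
  connected := by
    have key : ∀ y, u.Path x y → Relation.TransGen (fun a b => (a, b) ∈ u.E.filter
        fun e : ℤ × ℤ => (e.1 = (x : ℤ) ∨ u.Path x e.1) ∧ (e.2 = (x : ℤ) ∨ u.Path x e.2)) x y := by
      intro y h
      induction h with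
      | single h => exact .single (by
          rw [Finset.mem_filter]; exact ⟨h, Or.inl rfl, Or.inr (.single h)⟩)
      | tail hp h ih => exact ih.tail (by
          rw [Finset.mem_filter]; exact ⟨h, Or.inr hp, Or.inr (hp.tail h)⟩)
    intro a ha b hb hab
    simp only [Finset.mem_filter] at ha hb
    rcases ha.2 with rfl | ha'
    · rcases hb.2 with rfl | hb'
      · exact absurd rfl hab
      · exact Or.inl (key _ hb')
    · rcases hb.2 with rfl | hb'
      · exact Or.inr (Or.inl (key _ ha'))
      · exact Or.inr (Or.inr ⟨x, by simp, ha'.lt.ne, hb'.lt.ne, key _ ha', key _ hb'⟩)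

theorem Path.map {u v : LTree} (φ : u.V ≃ v.V)
    (h : ∀ x y : u.V, ((x : ℤ), (y : ℤ)) ∈ u.E ↔ ((φ x : ℤ), (φ y : ℤ)) ∈ v.E)
    {x y : u.V} (hp : u.Path x y) : v.Path (φ x) (φ y) := by
  obtain ⟨y, hy⟩ := y
  simp only [Path] at hp
  induction hp with
  | single hxy => exact .single ((h _ _).1 hxy)
  | tail hp hxy ih =>
    exact (ih (Path.mem_right hp)).tail ((h ⟨_, Path.mem_right hp⟩ ⟨_, hy⟩).1 hxy)

theorem path_map_iff {u v : LTree} (φ : u.V ≃ v.V)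
    (h : ∀ x y : u.V, ((x : ℤ), (y : ℤ)) ∈ u.E ↔ ((φ x : ℤ), (φ y : ℤ)) ∈ v.E)
    (x y : u.V) : u.Path x y ↔ v.Path (φ x) (φ y) := by
  refine ⟨Path.map φ h, fun hp => ?_⟩
  have := Path.map φ.symm (fun a b => by simpa using (h (φ.symm a) (φ.symm b)).symm) hp
  simpa using this

theorem map_root {u v : LTree} (φ : u.V ≃ v.V)
    (h : ∀ x y : u.V, ((x : ℤ), (y : ℤ)) ∈ u.E ↔ ((φ x : ℤ), (φ y : ℤ)) ∈ v.E) :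
    φ u.root = v.root := by
  refine v.root_unique _ fun x hx hne => ?_
  have := (path_map_iff φ h u.root (φ.symm ⟨x, hx⟩)).1 (u.path_root (φ.symm ⟨x, hx⟩).2 ?_)
  · simpa using this
  · intro hc
    apply hne
    rw [← Subtype.ext hc]
    simp

theorem mem_subtree_V {u : LTree} {x : u.V} {y : ℤ} :
    y ∈ (u.subtree x).V ↔ y ∈ u.V ∧ (y = x ∨ u.Path x y) := by
  simp [subtree]

theorem mem_subtree_E {u : LTree} {x : u.V} {a b : ℤ} :
    (a, b) ∈ (u.subtree x).E ↔
      (a, b) ∈ u.E ∧ (a = x ∨ u.Path x a) ∧ (b = x ∨ u.Path x b) := by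
  simp [subtree]

theorem subtree_iso {u v : LTree} (φ : u.V ≃ v.V)
    (h : ∀ x y : u.V, ((x : ℤ), (y : ℤ)) ∈ u.E ↔ ((φ x : ℤ), (φ y : ℤ)) ∈ v.E) (c : u.V) :
    Iso (u.subtree c) (v.subtree (φ c)) := by
  have hiff : ∀ y : u.V, ((y : ℤ) = c ∨ u.Path c y) ↔
      ((φ y : ℤ) = φ c ∨ v.Path (φ c) (φ y)) := by
    intro y
    rw [path_map_iff φ h c y, Subtype.coe_inj, Subtype.coe_inj, φ.apply_eq_iff_eq]
  refine ⟨⟨fun y => ⟨φ ⟨y, (mem_subtree_V.1 y.2).1⟩, ?_⟩,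
    fun y => ⟨φ.symm ⟨y, (mem_subtree_V.1 y.2).1⟩, ?_⟩, ?_, ?_⟩, ?_⟩
  · exact mem_subtree_V.2 ⟨(φ ⟨y, _⟩).2, (hiff _).1 (mem_subtree_V.1 y.2).2⟩
  · refine mem_subtree_V.2 ⟨(φ.symm ⟨y, _⟩).2, (hiff _).2 ?_⟩
    simpa using (mem_subtree_V.1 y.2).2
  · intro y; simp
  · intro y; simp
  · intro x y
    simp only [mem_subtree_E, Equiv.coe_fn_mk]
    have hx := mem_subtree_V.1 x.2
    have hy := mem_subtree_V.1 y.2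
    have hx' := (hiff ⟨x, hx.1⟩).1 hx.2
    have hy' := (hiff ⟨y, hy.1⟩).1 hy.2
    have hE := h ⟨x, hx.1⟩ ⟨y, hy.1⟩
    exact ⟨fun hp => ⟨hE.1 hp.1, hx', hy'⟩, fun hp => ⟨hE.2 hp.1, hx.2, hy.2⟩⟩

theorem card_subtree_lt (u : LTree) {c : u.V} (hc : c ∈ u.children u.root) :
    (u.subtree c).V.card < u.V.card := by
  have hlt : (u.root : ℤ) < c := (u.edge_mem _ _ (by simpa [children] using hc)).2.2
  refine Finset.card_lt_card ⟨fun y hy => (mem_subtree_V.1 hy).1, fun hsub => ?_⟩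
  rcases (mem_subtree_V.1 (hsub u.root.2)).2 with h | h
  · exact absurd h hlt.ne
  · exact absurd h.lt (not_lt.2 hlt.le)

end LTree

/-- Non-labelled trees: isomorphism classes of labelled trees. -/
def Tree : Type := Quotient LTree.setoid

/-- The non-labelled tree of a labelled tree. -/
def Tree.mk (u : LTree) : Tree := Quotient.mk _ u

instance : DecidableEq Tree := Classical.decEq _

namespace LTree

/-- The multiset of (classes of) subtrees hanging at the children of the root. -/
def branches (u : LTree) : Multiset Tree :=
  (u.children u.root).val.map fun c => Tree.mk (u.subtree c)

theorem branches_congr (u v : LTree) : Iso u v → u.branches = v.branches := by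
  rintro ⟨φ, h⟩
  have hc : v.children v.root = (u.children u.root).map φ.toEmbedding := by
    ext c
    rw [← map_root φ h]
    simp only [children, Finset.mem_filter, Finset.mem_univ, true_and, Finset.mem_map_equiv]
    simpa using (h u.root (φ.symm c)).symm
  rw [branches, branches, hc, Finset.map_val, Multiset.map_map]
  exact Multiset.map_congr rfl fun c _ => Quotient.sound (subtree_iso φ h c)

theorem card_congr (u v : LTree) : Iso u v → u.V.card = v.V.card := by
  rintro ⟨φ, _⟩
  simpa using Fintype.card_congr φ

end LTree

namespace Tree

/-- The order `r(t)`: the number of vertices. -/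
def r : Tree → ℕ := Quotient.lift (fun u : LTree => u.V.card) LTree.card_congr

/-- `t = [t₁ ⋯ t_l]` means that `t.branches` is the multiset `{t₁, …, t_l}`; the one-vertex
tree `τ` is the tree without branches (`l = 0`). -/
def branches : Tree → Multiset Tree := Quotient.lift LTree.branches LTree.branches_congr

theorem r_lt_of_mem_branches {t t' : Tree} (h : t' ∈ t.branches) : t'.r < t.r := by
  induction t using Quotient.inductionOn with
  | h u =>
    obtain ⟨c, hc, rfl⟩ := Multiset.mem_map.1 (show t' ∈ u.branches from h)
    exact u.card_subtree_lt hc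

/-- `α(t)`: the number of labelled trees equivalent to a labelled representative of `t`
(this number does not depend on the representative; one is chosen). -/
def α (t : Tree) : ℕ := Nat.card {u : LTree // u.Equivalent (Quotient.out t)}

/-- `σ(τ) = 1` and `σ([t₁^{m₁} ⋯ t_l^{m_l}]) = ∏ mᵢ! σ(tᵢ)^{mᵢ}` for distinct `tᵢ`. -/
def σ (t : Tree) : ℕ :=
  ∏ t' ∈ t.branches.toFinset.attach,
    (t.branches.count t'.1).factorial * σ t'.1 ^ t.branches.count t'.1
termination_by t.r
decreasing_by exact r_lt_of_mem_branches (Multiset.mem_toFinset.1 t'.2)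

/-- The derivative weights `ζ_i([t₁ ⋯ t_l]; A) = ∑_j a_{ij} ∏_k ζ_j(t_k; A)`; the case
`t = τ` is the empty product. -/
def ζ {K : ℕ} (A : Matrix (Fin K) (Fin K) ℝ) (t : Tree) (i : Fin K) : ℝ :=
  ∑ j, A i j * (t.branches.attach.map fun t' => ζ A t'.1 j).prod
termination_by t.r
decreasing_by exact r_lt_of_mem_branches t'.2

/-- The elementary differentials
`D(W, [t₁ ⋯ t_l])(x) = W^{(l)}(x)(D(W,t₁)(x), …, D(W,t_l)(x))`; the case `t = τ` is the
zeroth derivative `W(x)`. -/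
def D {N : ℕ} (W : EuclideanSpace ℝ (Fin N) → EuclideanSpace ℝ (Fin N)) (t : Tree)
    (x : EuclideanSpace ℝ (Fin N)) : EuclideanSpace ℝ (Fin N) :=
  iteratedFDeriv ℝ t.branches.toList.length W x
    fun k => D W (t.branches.toList.get k) x
termination_by t.r
decreasing_by exact r_lt_of_mem_branches (Multiset.mem_toList.1 (List.get_mem _ _))

theorem σ_eq (t : Tree) : t.σ =
    ∏ t' ∈ t.branches.toFinset, (t.branches.count t').factorial * σ t' ^ t.branches.count t' := by
  rw [σ]
  exact Finset.prod_attach t.branches.toFinset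
    (fun t' => (t.branches.count t').factorial * σ t' ^ t.branches.count t')

theorem ζ_eq {K : ℕ} (A : Matrix (Fin K) (Fin K) ℝ) (t : Tree) (i : Fin K) :
    ζ A t i = ∑ j, A i j * (t.branches.map fun t' => ζ A t' j).prod := by
  rw [ζ]
  exact Finset.sum_congr rfl fun j _ => by rw [Multiset.attach_map_val' t.branches (ζ A · j)]

theorem finite_r_le (m : ℕ) : {t : Tree | t.r ≤ m}.Finite := by
  have hn : ∀ n : ℕ, {t : Tree | t.r = n}.Finite := by
    intro n
    have hcard : ∀ t : {t : Tree // t.r = n}, (Quotient.out t.1 : LTree).V.card = n := by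
      rintro ⟨t, rfl⟩
      conv_rhs => rw [← Quotient.out_eq t]
      rfl
    let f : {t : Tree // t.r = n} → Set (Fin n × Fin n) := fun t =>
      {p | (((Quotient.out t.1 : LTree).V.orderIsoOfFin (hcard t) p.1 : ℤ),
        ((Quotient.out t.1 : LTree).V.orderIsoOfFin (hcard t) p.2 : ℤ)) ∈
          (Quotient.out t.1 : LTree).E}
    have hf : Function.Injective f := by
      intro t t' h
      apply Subtype.ext
      rw [← Quotient.out_eq t.1, ← Quotient.out_eq t'.1]
      refine Quotient.sound ⟨((Finset.orderIsoOfFin _ (hcard t)).symm.trans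
        (Finset.orderIsoOfFin _ (hcard t'))).toEquiv, fun x y => ?_⟩
      have := Set.ext_iff.1 h ((Finset.orderIsoOfFin _ (hcard t)).symm x,
        (Finset.orderIsoOfFin _ (hcard t)).symm y)
      simp only [f, Set.mem_ofPred_eq, OrderIso.apply_symm_apply] at this
      exact this
    exact Set.finite_coe_iff.1 (Finite.of_injective f hf)
  have : {t : Tree | t.r ≤ m} = ⋃ n ∈ Finset.range (m + 1), {t : Tree | t.r = n} := by
    ext t; simp
  rw [this]
  exact Set.Finite.biUnion (Finset.finite_toSet _) fun n _ => hn n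

/-- `T_{≤ m}`: the non-labelled trees with at most `m` vertices. -/
def upTo (m : ℕ) : Finset Tree := (finite_r_le m).toFinset

end Tree

/-! ### Vector fields, flows, Runge–Kutta methods -/

/-- `C_b^∞(ℝ^N; ℝ^N)`: smooth maps that are bounded together with all their derivatives. -/
def CbSmooth {N : ℕ} (V : EuclideanSpace ℝ (Fin N) → EuclideanSpace ℝ (Fin N)) : Prop :=
  ContDiff ℝ ((⊤ : ℕ∞) : WithTop ℕ∞) V ∧ ∀ n : ℕ, ∃ M : ℝ, ∀ x, ‖iteratedFDeriv ℝ n V x‖ ≤ M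

/-- `‖V^{(n)}‖`: the supremum of `|V^{(n)}(x)(U₁, …, U_n)|` over all points `x` and all unit
vectors `U₁, …, U_n`. -/
def derivNorm {N : ℕ} (n : ℕ) (V : EuclideanSpace ℝ (Fin N) → EuclideanSpace ℝ (Fin N)) : ℝ :=
  sSup {a : ℝ | ∃ (x : EuclideanSpace ℝ (Fin N)) (U : Fin n → EuclideanSpace ℝ (Fin N)),
    (∀ i, ‖U i‖ = 1) ∧ a = ‖iteratedFDeriv ℝ n V x U‖}

/-- `‖V‖_{C^n} = ∑_{i=0}^n ‖V^{(i)}‖`. -/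
def cNorm {N : ℕ} (n : ℕ) (V : EuclideanSpace ℝ (Fin N) → EuclideanSpace ℝ (Fin N)) : ℝ :=
  ∑ i ∈ Finset.range (n + 1), derivNorm i V

/-- `z` solves `dz/dt = V(z)`, `z(0) = x` on the time interval `[0, a]`. -/
def IsSolution {N : ℕ} (V : EuclideanSpace ℝ (Fin N) → EuclideanSpace ℝ (Fin N))
    (x : EuclideanSpace ℝ (Fin N)) (a : ℝ) (z : ℝ → EuclideanSpace ℝ (Fin N)) : Prop :=
  z 0 = x ∧ ∀ t ∈ Set.Icc 0 a, HasDerivWithinAt z (V (z t)) (Set.Icc 0 a) t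

open Classical in
/-- `exp(V)(x)`: the value at time `1` of the solution of `dz/dt = V(z)`, `z(0) = x`
(which for `V` in `C_b^∞` exists and is unique). -/
def flow {N : ℕ} (V : EuclideanSpace ℝ (Fin N) → EuclideanSpace ℝ (Fin N))
    (x : EuclideanSpace ℝ (Fin N)) : EuclideanSpace ℝ (Fin N) :=
  if h : ∃ z, IsSolution V x 1 z then h.choose 1 else x

theorem CbSmooth.smul {N : ℕ} {V : EuclideanSpace ℝ (Fin N) → EuclideanSpace ℝ (Fin N)}
    (hV : CbSmooth V) (s : ℝ) : CbSmooth (s • V) := by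
  refine ⟨hV.1.const_smul s, fun n => ?_⟩
  obtain ⟨M, hM⟩ := hV.2 n
  refine ⟨‖s‖ * M, fun x => ?_⟩
  rw [iteratedFDeriv_const_smul_apply ((hV.1.of_le (by exact_mod_cast le_top)).contDiffAt),
    norm_smul]
  exact mul_le_mul_of_nonneg_left (hM x) (norm_nonneg _)

theorem CbSmooth.lipschitz {N : ℕ} {V : EuclideanSpace ℝ (Fin N) → EuclideanSpace ℝ (Fin N)}
    (hV : CbSmooth V) : ∃ L : NNReal, LipschitzWith L V := by
  obtain ⟨M, hM⟩ := hV.2 1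
  have hM0 : 0 ≤ M := (norm_nonneg _).trans (hM 0)
  refine ⟨⟨M, hM0⟩, lipschitzWith_of_nnnorm_fderiv_le
    (hV.1.differentiable (by simp)) fun x => ?_⟩
  have := hM x
  rw [norm_iteratedFDeriv_one] at this
  exact this

theorem CbSmooth.exists_isSolution {N : ℕ}
    {V : EuclideanSpace ℝ (Fin N) → EuclideanSpace ℝ (Fin N)} (hV : CbSmooth V)
    (x : EuclideanSpace ℝ (Fin N)) {a : ℝ} (ha : 0 ≤ a) : ∃ z, IsSolution V x a z := by
  obtain ⟨M, hM⟩ := hV.2 0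
  obtain ⟨L, hL⟩ := hV.lipschitz
  have hM0 : 0 ≤ M := (norm_nonneg _).trans (hM 0)
  have hp : IsPicardLindelof (fun _ => V) (tmin := 0) (tmax := a) ⟨0, le_rfl, ha⟩ x
      ⟨M * a, mul_nonneg hM0 ha⟩ 0 ⟨M, hM0⟩ L :=
    { lipschitzOnWith := fun t _ => hL.lipschitzOnWith
      continuousOn := fun y _ => continuousOn_const
      norm_le := fun t _ y _ => by
        have h := hM y
        rw [norm_iteratedFDeriv_zero] at h
        exact h
      mul_max_le := by
        have : max (a - 0) (0 - 0) = a := by simp [ha]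
        change M * max (a - 0) (0 - 0) ≤ M * a - 0
        rw [this, sub_zero] }
  obtain ⟨z, hz0, hz⟩ := hp.exists_eq_forall_mem_Icc_hasDerivWithinAt₀
  exact ⟨z, hz0, hz⟩

theorem CbSmooth.isSolution_unique {N : ℕ}
    {V : EuclideanSpace ℝ (Fin N) → EuclideanSpace ℝ (Fin N)} (hV : CbSmooth V)
    {x : EuclideanSpace ℝ (Fin N)} {a : ℝ} {z w : ℝ → EuclideanSpace ℝ (Fin N)}
    (hz : IsSolution V x a z) (hw : IsSolution V x a w) : Set.EqOn z w (Set.Icc 0 a) := by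
  obtain ⟨L, hL⟩ := hV.lipschitz
  have side : ∀ {g : ℝ → EuclideanSpace ℝ (Fin N)}, IsSolution V x a g →
      ∀ t ∈ Set.Ico 0 a, HasDerivWithinAt g (V (g t)) (Set.Ici t) t := fun hg t ht =>
    (hg.2 t ⟨ht.1, ht.2.le⟩).mono_of_mem_nhdsWithin
      (Filter.mem_of_superset (Icc_mem_nhdsGE ht.2) (Set.Icc_subset_Icc_left ht.1))
  exact ODE_solution_unique (v := fun _ => V) (fun _ => hL)
    (fun t ht => (hz.2 t ht).continuousWithinAt) (side hz)
    (fun t ht => (hw.2 t ht).continuousWithinAt) (side hw) (hz.1.trans hw.1.symm)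

/-- `exp(sW)(y₀)` is the value at time `s` of any solution of `dy/ds = W(y)`, `y(0) = y₀`. -/
theorem CbSmooth.flow_smul_eq {N : ℕ}
    {W : EuclideanSpace ℝ (Fin N) → EuclideanSpace ℝ (Fin N)} (hW : CbSmooth W)
    {y₀ : EuclideanSpace ℝ (Fin N)} {s : ℝ} (hs : 0 ≤ s) {y : ℝ → EuclideanSpace ℝ (Fin N)}
    (hy : IsSolution W y₀ s y) : flow (s • W) y₀ = y s := by
  have hz : IsSolution (s • W) y₀ 1 (fun t => y (s * t)) := by
    refine ⟨by simpa using hy.1, fun t ht => ?_⟩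
    have hmaps : Set.MapsTo (fun t : ℝ => s * t) (Set.Icc 0 1) (Set.Icc 0 s) := fun t ht =>
      ⟨mul_nonneg hs ht.1, mul_le_of_le_one_right hs ht.2⟩
    have h1 : HasDerivWithinAt (fun t : ℝ => s * t) s (Set.Icc 0 1) t := by
      simpa using ((hasDerivAt_id t).const_mul s).hasDerivWithinAt
    exact (hy.2 (s * t) (hmaps ht)).scomp t h1 hmaps
  have hex : ∃ z, IsSolution (s • W) y₀ 1 z := ⟨_, hz⟩
  rw [flow, dif_pos hex]
  simpa using (hW.smul s).isSolution_unique hex.choose_spec hz (Set.right_mem_Icc.2 zero_le_one)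

/-- The stage equations `Y_i = y₀ + s ∑_j a_{ij} W(Y_j)` of a `K`-stage Runge–Kutta method. -/
def IsStages {N K : ℕ} (A : Matrix (Fin K) (Fin K) ℝ)
    (W : EuclideanSpace ℝ (Fin N) → EuclideanSpace ℝ (Fin N)) (y₀ : EuclideanSpace ℝ (Fin N))
    (s : ℝ) (Y : Fin K → EuclideanSpace ℝ (Fin N)) : Prop :=
  ∀ i, Y i = y₀ + s • ∑ j, A i j • W (Y j)

/-- The output `y₀ + s ∑_i b_i W(Y_i)` of a Runge–Kutta method with stages `Y`. -/
def rkOutput {N K : ℕ} (b : Fin K → ℝ)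
    (W : EuclideanSpace ℝ (Fin N) → EuclideanSpace ℝ (Fin N)) (y₀ : EuclideanSpace ℝ (Fin N))
    (s : ℝ) (Y : Fin K → EuclideanSpace ℝ (Fin N)) : EuclideanSpace ℝ (Fin N) :=
  y₀ + s • ∑ i, b i • W (Y i)

end RKTree

end

noncomputable section

namespace RKTree

/-! Both parts rest on the recursive structure of trees and on the bound `|D(W,t)| ≤ ‖W‖^r(t)`, with
`‖W‖` the `C^(m+1)` norm (`norm_D_le`). A tree is the same as the multiset of its branches
(`branchesEquiv`), and by symmetry of higher derivatives `D(W,t)` can be computed from any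
enumeration of them (`D_eq`).

Flow. By the product rule, the derivative of `D(W,u)` along `W` is the sum over the vertices `v` of
`u` of `D(W,·)` at the tree with a new leaf at `v` (`hasFDerivAt_D`). Giving the new leaf the
largest label produces every labelled tree on `n + 1` vertices exactly once (`sum_labelled_succ`).
So the `q`-th derivative of a solution is the sum of `D(W,u)` over the labelled trees `u` on `q`
vertices; `α` counts them by isomorphism class (`Tree.α_eq`), and Taylor's formula concludes.

Runge–Kutta. Put `h = s‖W‖`. For `h ≤ 1`, `s W(Y_j)` is expanded by induction on the order
(`stage_expansion`): an expansion of all `s W(Y_k)` up to `O(h^(m+1))` gives one of `Y_j - y₀` by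
the stage equations, and substituting it into the Taylor polynomial of `s W` gains one power of `h`.
Multilinearity turns this into a sum over tuples of trees. A multiset of `l` branches with
multiplicities `m_i` has `l!/∏ m_i!` enumerations (`card_tuples_mul`), which turns the Taylor factor
`1/l!` into `1/σ(t)`. For `h ≥ 1` every term is separately `O(h^(m+1))`. The stages are given, so no
solvability argument is needed. -/

theorem exists_equiv_of_map_univ_eq {ι κ β : Type*} [Fintype ι] [Fintype κ] {f : ι → β} {g : κ → β}
    (h : (Finset.univ : Finset ι).val.map f = (Finset.univ : Finset κ).val.map g) :
    ∃ e : ι ≃ κ, ∀ i, f i = g (e i) := by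
  classical
  -- Equal multisets of values mean equally large fibres over each value; bijections of the fibres
  -- are then glued.
  have hc : ∀ b, Nonempty ({i // f i = b} ≃ {k // g k = b}) := by
    intro b
    have := congrArg (Multiset.count b) h
    rw [Multiset.count_map, Multiset.count_map] at this
    refine ⟨Fintype.equivOfCardEq ?_⟩
    rw [Fintype.card_subtype, Fintype.card_subtype]
    simpa [Finset.card, eq_comm] using this
  let e := fun b => (hc b).some
  exact ⟨Equiv.ofFiberEquiv e, fun i => (Equiv.ofFiberEquiv_map e i).symm⟩

/-! ### Decomposition of a tree into its root and its branches. -/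

namespace LTree

/-- `y` is a descendant of `x`, or `x` itself. -/
def Reach (u : LTree) (x y : ℤ) : Prop := y = x ∨ u.Path x y

theorem Reach.le {u : LTree} {x y : ℤ} (h : u.Reach x y) : x ≤ y := by
  rcases h with rfl | h
  · exact le_rfl
  · exact h.lt.le

theorem Reach.path {u : LTree} {x y z : ℤ} (h : u.Reach x y) (e : (y, z) ∈ u.E) : u.Path x z := by
  rcases h with rfl | h
  · exact .single e
  · exact h.tail e

theorem mem_subtree {u : LTree} {x : u.V} {y : ℤ} :
    y ∈ (u.subtree x).V ↔ y ∈ u.V ∧ u.Reach x y := mem_subtree_V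

theorem mem_subtree_edge {u : LTree} {x : u.V} {a b : ℤ} :
    (a, b) ∈ (u.subtree x).E ↔ (a, b) ∈ u.E ∧ u.Reach x a := by
  rw [mem_subtree_E]
  exact ⟨fun h => ⟨h.1, h.2.1⟩, fun h => ⟨h.1, h.2, Or.inr (h.2.path h.1)⟩⟩

theorem reach_root (u : LTree) {x : ℤ} (hx : x ∈ u.V) : u.Reach u.root x :=
  or_iff_not_imp_left.2 fun h => u.path_root hx h

/-- The last edge of a path. -/
theorem Path.last {u : LTree} {x y : ℤ} (h : u.Path x y) : ∃ p, u.Reach x p ∧ (p, y) ∈ u.E := by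
  cases h with
  | single h => exact ⟨x, Or.inl rfl, h⟩
  | tail h e => exact ⟨_, Or.inr h, e⟩

theorem not_mem_edge_root (u : LTree) (x : ℤ) : (x, (u.root : ℤ)) ∉ u.E := fun h =>
  absurd (u.edge_mem _ _ h).2.2 (not_lt.2 (u.root_le (u.edge_mem _ _ h).1))

theorem not_reach_of_child {u : LTree} {c : ℤ} (hc : ((u.root : ℤ), c) ∈ u.E) :
    ¬ u.Reach c u.root := fun h =>
  absurd h.le (not_le.2 (u.edge_mem _ _ hc).2.2)

/-- Subtrees hanging at distinct children of the root are disjoint. -/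
theorem child_unique {u : LTree} {c c' x : ℤ} (hc : ((u.root : ℤ), c) ∈ u.E)
    (hc' : ((u.root : ℤ), c') ∈ u.E) (h : u.Reach c x) (h' : u.Reach c' x) : c = c' := by
  -- The only parent of a child of the root is the root, so a path between two children would pass
  -- through the root and labels would decrease.
  have base : ∀ {d d' : ℤ}, ((u.root : ℤ), d) ∈ u.E → ((u.root : ℤ), d') ∈ u.E →
      ¬ u.Path d d' := by
    intro d d' hd hd' hp
    obtain ⟨p, hp, he⟩ := hp.last
    rw [u.parent_unique _ _ _ he hd'] at hp
    exact not_reach_of_child hd hp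
  rcases h with rfl | h
  · rcases h' with rfl | h'
    · rfl
    · exact absurd h' (base hc' hc)
  -- Walk back from `x` towards `c`: since parents are unique, a path from `c'` must retrace the
  -- same edges.
  · induction h with
    | single e =>
      rcases h' with rfl | h'
      · exact absurd (.single e) (base hc hc')
      · obtain ⟨p, hp, he⟩ := h'.last
        rw [u.parent_unique _ _ _ he e] at hp
        rcases hp with h | hp
        · exact h
        · exact absurd hp (base hc' hc)
    | tail hp e ih =>
      rcases h' with rfl | h'
      · exact absurd (hp.tail e) (base hc hc')
      · obtain ⟨p, hp, he⟩ := h'.last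
        rw [u.parent_unique _ _ _ he e] at hp
        exact ih hp

theorem exists_child {u : LTree} {x : ℤ} (hx : x ∈ u.V) (hne : x ≠ u.root) :
    ∃ c, ((u.root : ℤ), c) ∈ u.E ∧ u.Reach c x := by
  obtain ⟨c, hc, h⟩ := Relation.TransGen.head'_iff.1 (u.path_root hx hne)
  exact ⟨c, hc, Relation.reflTransGen_iff_eq_or_transGen.1 h⟩

theorem mem_children {u : LTree} {c : u.V} :
    c ∈ u.children u.root ↔ ((u.root : ℤ), (c : ℤ)) ∈ u.E := by
  simp [children]

theorem subtree_root (u : LTree) (x : u.V) : ((u.subtree x).root : ℤ) = x := by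
  have hx : (x : ℤ) ∈ (u.subtree x).V := mem_subtree.2 ⟨x.2, Or.inl rfl⟩
  refine le_antisymm ((u.subtree x).root_le hx) ?_
  exact (mem_subtree.1 (u.subtree x).root.2).2.le

/-- The decomposition of the vertices of a tree into the root and the vertices of the subtrees
hanging at the children of the root. -/
def decomp (u : LTree) : Option (Σ c : u.children u.root, (u.subtree c.1).V) → u.V
  | none => u.root
  | some p => ⟨p.2, (mem_subtree.1 p.2.2).1⟩

theorem decomp_bijective (u : LTree) : Function.Bijective u.decomp := by
  constructor
  · rintro (_ | ⟨⟨c, hc⟩, x, hx⟩) (_ | ⟨⟨c', hc'⟩, x', hx'⟩) h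
    · rfl
    · exfalso
      have h1 : (u.root : ℤ) = x' := congrArg Subtype.val h
      subst h1
      exact not_reach_of_child (mem_children.1 hc') (mem_subtree.1 hx').2
    · exfalso
      have h1 : x = (u.root : ℤ) := congrArg Subtype.val h
      subst h1
      exact not_reach_of_child (mem_children.1 hc) (mem_subtree.1 hx).2
    · have h1 : x = x' := congrArg Subtype.val h
      subst h1
      have h2 : c = c' := Subtype.ext (child_unique (mem_children.1 hc) (mem_children.1 hc')
        (mem_subtree.1 hx).2 (mem_subtree.1 hx').2)
      subst h2
      rfl
  · intro x
    by_cases hx : (x : ℤ) = u.root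
    · exact ⟨none, Subtype.ext hx.symm⟩
    · obtain ⟨c, hc, h⟩ := exists_child x.2 hx
      exact ⟨some ⟨⟨⟨c, (u.edge_mem _ _ hc).2.1⟩, mem_children.2 hc⟩,
        x, mem_subtree.2 ⟨x.2, h⟩⟩, rfl⟩

theorem card_eq (u : LTree) :
    u.V.card = 1 + ∑ c : u.children u.root, (u.subtree c.1).V.card := by
  have := Fintype.card_of_bijective u.decomp_bijective
  simpa [add_comm] using this.symm

theorem decomp_edge_root (u : LTree) (c : u.children u.root) (x : (u.subtree c.1).V) :
    ((u.root : ℤ), (x : ℤ)) ∈ u.E ↔ x = (u.subtree c.1).root := by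
  have hc := mem_children.1 c.2
  constructor
  · intro h
    apply Subtype.ext
    rw [subtree_root]
    exact child_unique h hc (Or.inl rfl) (mem_subtree.1 x.2).2
  · rintro rfl
    rwa [subtree_root]

/-- Trees whose subtrees at the children of the roots correspond are isomorphic. -/
theorem iso_of_children {u v : LTree} (e : u.children u.root ≃ v.children v.root)
    (h : ∀ c, Iso (u.subtree c.1) (v.subtree (e c).1)) : Iso u v := by
  choose φ hφ using h
  let F : u.V ≃ v.V := (Equiv.ofBijective _ u.decomp_bijective).symm.trans
    ((Equiv.optionCongr (Equiv.sigmaCongr e φ)).trans (Equiv.ofBijective _ v.decomp_bijective))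
  have hF : ∀ p, F (u.decomp p) = v.decomp (Equiv.optionCongr (Equiv.sigmaCongr e φ) p) := by
    intro p
    have : (Equiv.ofBijective _ u.decomp_bijective).symm (u.decomp p) = p :=
      (Equiv.ofBijective _ u.decomp_bijective).symm_apply_apply p
    simp [F, this]
  refine ⟨F, fun x y => ?_⟩
  obtain ⟨p, rfl⟩ := u.decomp_bijective.2 x
  obtain ⟨q, rfl⟩ := u.decomp_bijective.2 y
  rw [hF, hF]
  rcases q with _ | ⟨c', y⟩
  · exact iff_of_false (u.not_mem_edge_root _) (v.not_mem_edge_root _)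
  rcases p with _ | ⟨c, x⟩
  · have h1 := u.decomp_edge_root c' y
    have h2 := v.decomp_edge_root (e c') (φ c' y)
    rw [← map_root (φ c') (hφ c'), (φ c').apply_eq_iff_eq] at h2
    exact h1.trans h2.symm
  -- No edge joins two branches: the child above its source also lies above its end.
  · have key : ∀ (w : LTree) (d d' : w.children w.root) (a : (w.subtree d.1).V)
        (b : (w.subtree d'.1).V), ((a : ℤ), (b : ℤ)) ∈ w.E → d = d' := by
      intro w d d' a b hab
      exact Subtype.ext (Subtype.ext (child_unique (mem_children.1 d.2) (mem_children.1 d'.2)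
        (Or.inr ((mem_subtree.1 a.2).2.path hab)) (mem_subtree.1 b.2).2))
    by_cases hcc : c = c'
    · subst hcc
      have h1 := hφ c x y
      rw [mem_subtree_edge, mem_subtree_edge] at h1
      simp only [(mem_subtree.1 x.2).2, (mem_subtree.1 (φ c x).2).2, and_true] at h1
      exact h1
    · refine iff_of_false (fun h => hcc (key u _ _ x y h)) (fun h => hcc ?_)
      exact e.injective (key v _ _ (φ c x) (φ c' y) h)

/-- The branches, computed from an enumeration of the children of the root. -/
theorem branches_eq_map {ι : Type*} [Fintype ι] (u : LTree) (c : ι → u.V)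
    (hinj : Function.Injective c)
    (hc : ∀ x : u.V, ((u.root : ℤ), (x : ℤ)) ∈ u.E ↔ ∃ i, c i = x) :
    u.branches = Finset.univ.val.map fun i => Tree.mk (u.subtree (c i)) := by
  have : u.children u.root = Finset.univ.map ⟨c, hinj⟩ := by
    ext x
    rw [mem_children, hc]
    simp
  rw [branches, this, Finset.map_val, Multiset.map_map]
  rfl

theorem branches_eq_univ (u : LTree) : u.branches =
    (Finset.univ : Finset (u.children u.root)).val.map fun c => Tree.mk (u.subtree c.1) :=
  branches_eq_map u _ Subtype.val_injective fun x => by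
    rw [← mem_children]
    simp

end LTree

namespace Tree

theorem exists_mk (t : Tree) : ∃ u, Tree.mk u = t := Quotient.exists_rep t

theorem mk_eq_iff {u v : LTree} : Tree.mk u = Tree.mk v ↔ LTree.Iso u v := Quotient.eq

theorem branches_mk (u : LTree) : (Tree.mk u).branches = u.branches := rfl

theorem r_mk (u : LTree) : (Tree.mk u).r = u.V.card := rfl

theorem r_pos (t : Tree) : 0 < t.r := by
  obtain ⟨u, rfl⟩ := t.exists_mk
  exact u.nonempty.card_pos

theorem r_eq (t : Tree) : t.r = 1 + (t.branches.map r).sum := by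
  obtain ⟨u, rfl⟩ := t.exists_mk
  rw [r_mk, u.card_eq, branches_mk, u.branches_eq_univ, Multiset.map_map]
  rfl

theorem card_branches_lt (t : Tree) : t.branches.card < t.r := by
  have : (t.branches.map fun _ => 1).sum ≤ (t.branches.map r).sum :=
    Multiset.sum_map_le_sum_map _ _ fun i _ => r_pos i
  simp at this
  rw [r_eq]
  omega

/-- Equality of the multisets pairs the children of the two roots so that paired subtrees are
isomorphic; these isomorphisms glue. This is what makes the notation `[t₁ ⋯ t_l]` determine a tree.
-/
theorem branches_injective : Function.Injective branches := by
  intro t t' h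
  obtain ⟨u, rfl⟩ := t.exists_mk
  obtain ⟨v, rfl⟩ := t'.exists_mk
  rw [branches_mk, branches_mk, u.branches_eq_univ, v.branches_eq_univ] at h
  obtain ⟨e, he⟩ := exists_equiv_of_map_univ_eq h
  exact mk_eq_iff.2 (LTree.iso_of_children e fun c => mk_eq_iff.1 (he c))

end Tree

/-! ### Attaching and removing a leaf of largest label. -/

namespace LTree

/-- Attach a leaf with label `L`, larger than all labels of `u`, at the vertex `v`. -/
def attach (u : LTree) (v : ℤ) (hv : v ∈ u.V) (L : ℤ) (hL : ∀ x ∈ u.V, x < L) : LTree where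
  V := insert L u.V
  E := insert (v, L) u.E
  nonempty := ⟨L, by simp⟩
  edge_mem := by
    intro x y h
    simp only [Finset.mem_insert, Prod.mk.injEq] at h ⊢
    rcases h with ⟨rfl, rfl⟩ | h
    · exact ⟨Or.inr hv, Or.inl rfl, hL _ hv⟩
    · have := u.edge_mem x y h
      exact ⟨Or.inr this.1, Or.inr this.2.1, this.2.2⟩
  parent_unique := by
    intro x x' y h h'
    simp only [Finset.mem_insert, Prod.mk.injEq] at h h'
    rcases h with ⟨rfl, rfl⟩ | h
    · rcases h' with ⟨rfl, _⟩ | h'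
      · rfl
      · exact absurd (hL _ (u.edge_mem _ _ h').2.1) (lt_irrefl _)
    · rcases h' with ⟨rfl, rfl⟩ | h'
      · exact absurd (hL _ (u.edge_mem _ _ h).2.1) (lt_irrefl _)
      · exact u.parent_unique _ _ _ h h'
  connected := by
    have lift : ∀ {x y : ℤ}, Relation.TransGen (fun a b => (a, b) ∈ u.E) x y →
        Relation.TransGen (fun a b => (a, b) ∈ insert (v, L) u.E) x y :=
      Relation.TransGen.mono (fun _ _ h => Finset.mem_insert_of_mem h) _ _
    -- Connectedness is checked from the root only: two non-root vertices then have the root as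
    -- common ancestor.
    have key : ∀ x ∈ insert L u.V, x ≠ u.root →
        Relation.TransGen (fun a b => (a, b) ∈ insert (v, L) u.E) u.root x := by
      intro x hx hne
      rcases Finset.mem_insert.1 hx with rfl | hx
      · rcases u.reach_root hv with h | h
        · exact .single (by rw [← h]; exact Finset.mem_insert_self _ _)
        · exact (lift h).tail (Finset.mem_insert_self _ _)
      · exact lift (u.path_root hx hne)
    intro x hx y hy hxy
    by_cases h : x = u.root
    · subst h
      exact Or.inl (key y hy hxy.symm)
    · by_cases h' : y = u.root
      · subst h'
        exact Or.inr (Or.inl (key x hx h))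
      · exact Or.inr (Or.inr ⟨u.root, Finset.mem_insert_of_mem u.root.2, Ne.symm h, Ne.symm h',
          key x hx h, key y hy h'⟩)

section Attach

variable {u : LTree} {v : ℤ} {hv : v ∈ u.V} {L : ℤ} {hL : ∀ x ∈ u.V, x < L}

theorem mem_attach_V {x : ℤ} : x ∈ (u.attach v hv L hL).V ↔ x = L ∨ x ∈ u.V := by
  simp [attach]

theorem mem_attach_E {x y : ℤ} :
    (x, y) ∈ (u.attach v hv L hL).E ↔ (x = v ∧ y = L) ∨ (x, y) ∈ u.E := by
  simp [attach]

theorem card_attach : (u.attach v hv L hL).V.card = u.V.card + 1 :=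
  Finset.card_insert_of_notMem fun h => lt_irrefl _ (hL _ h)

/-- The new vertex `L` has no outgoing edge, so a path ending elsewhere never uses the new edge. -/
theorem path_attach {x y : ℤ} (hy : y ≠ L) : (u.attach v hv L hL).Path x y ↔ u.Path x y := by
  constructor
  · intro h
    induction h with
    | single e => exact .single ((mem_attach_E.1 e).resolve_left fun h => hy h.2)
    | tail hp e ih =>
      have e' := (mem_attach_E.1 e).resolve_left fun h => hy h.2
      exact (ih (hL _ (u.edge_mem _ _ e').1).ne).tail e'
  · exact Relation.TransGen.mono (fun _ _ h => mem_attach_E.2 (Or.inr h)) _ _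

theorem reach_attach {x y : ℤ} (hy : y ≠ L) : (u.attach v hv L hL).Reach x y ↔ u.Reach x y :=
  or_congr Iff.rfl (path_attach hy)

theorem reach_attach_leaf {x : ℤ} (hx : x ≠ L) :
    (u.attach v hv L hL).Reach x L ↔ u.Reach x v := by
  have hvL := (hL v hv).ne
  constructor
  · intro h
    obtain ⟨p, hp, he⟩ := (h.resolve_left hx.symm).last
    rcases mem_attach_E.1 he with ⟨rfl, _⟩ | he
    · exact (reach_attach hvL).1 hp
    · exact absurd (hL _ (u.edge_mem _ _ he).2.1) (lt_irrefl _)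
  · intro h
    exact Or.inr (((reach_attach hvL).2 h).path (mem_attach_E.2 (Or.inl ⟨rfl, rfl⟩)))

theorem root_attach : ((u.attach v hv L hL).root : ℤ) = u.root := by
  refine le_antisymm (root_le _ (mem_attach_V.2 (Or.inr u.root.2))) ?_
  rcases mem_attach_V.1 (u.attach v hv L hL).root.2 with h | h
  · rw [h]
    exact (hL _ u.root.2).le
  · exact u.root_le h

theorem subtree_attach_of_not_reach {x : ℤ} (hx : x ∈ u.V) (hx' : x ∈ (u.attach v hv L hL).V)
    (h : ¬ u.Reach x v) : (u.attach v hv L hL).subtree ⟨x, hx'⟩ = u.subtree ⟨x, hx⟩ := by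
  have hxL := (hL x hx).ne
  ext y
  · rw [mem_subtree, mem_subtree, mem_attach_V]
    by_cases hy : y = L
    · subst hy
      rw [reach_attach_leaf hxL]
      exact iff_of_false (fun h' => h h'.2) (fun h' => lt_irrefl _ (hL _ h'.1))
    · rw [reach_attach hy]
      simp [hy]
  · obtain ⟨a, b⟩ := y
    rw [mem_subtree_edge, mem_subtree_edge, mem_attach_E]
    by_cases ha : a = L
    · subst ha
      rw [reach_attach_leaf hxL]
      exact iff_of_false (fun h' => h h'.2) (fun h' => lt_irrefl _ (hL _ (u.edge_mem _ _ h'.1).1))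
    · rw [reach_attach ha]
      constructor
      · rintro ⟨⟨rfl, _⟩ | h1, h2⟩
        · exact absurd h2 h
        · exact ⟨h1, h2⟩
      · rintro ⟨h1, h2⟩
        exact ⟨Or.inr h1, h2⟩

/-- Taking the subtree at an ancestor of `v` commutes with attaching the leaf. It is an equality,
labels included, so a leaf attached to a tree can be followed into one of its branches. -/
theorem subtree_attach_of_reach {x : ℤ} (hx : x ∈ u.V) (hx' : x ∈ (u.attach v hv L hL).V)
    (h : u.Reach x v) : (u.attach v hv L hL).subtree ⟨x, hx'⟩ =
      (u.subtree ⟨x, hx⟩).attach v (mem_subtree.2 ⟨hv, h⟩) L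
        (fun y hy => hL y (mem_subtree.1 hy).1) := by
  have hxL := (hL x hx).ne
  ext y
  · rw [mem_subtree, mem_attach_V (u := u), mem_attach_V (u := u.subtree ⟨x, hx⟩), mem_subtree]
    by_cases hy : y = L
    · subst hy
      rw [reach_attach_leaf hxL]
      simp [h]
    · rw [reach_attach hy]
      simp [hy]
  · obtain ⟨a, b⟩ := y
    rw [mem_subtree_edge, mem_attach_E (u := u), mem_attach_E (u := u.subtree ⟨x, hx⟩),
      mem_subtree_edge]
    by_cases ha : a = L
    · subst ha
      rw [reach_attach_leaf hxL]
      have h1 : a ≠ v := (hL _ hv).ne'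
      have h2 : (a, b) ∉ u.E := fun h' => lt_irrefl _ (hL _ (u.edge_mem _ _ h').1)
      simp [h1, h2]
    · rw [reach_attach ha]
      constructor
      · rintro ⟨h1 | h1, h2⟩
        · exact Or.inl h1
        · exact Or.inr ⟨h1, h2⟩
      · rintro (⟨rfl, rfl⟩ | ⟨h1, h2⟩)
        · exact ⟨Or.inl ⟨rfl, rfl⟩, h⟩
        · exact ⟨Or.inr h1, h2⟩

theorem mem_attach_of_mem {x : ℤ} (hx : x ∈ u.V) : x ∈ (u.attach v hv L hL).V :=
  mem_attach_V.2 (Or.inr hx)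

theorem branches_of_card_eq_one (u : LTree) (h : u.V.card = 1) : u.branches = 0 := by
  have := (Tree.mk u).card_branches_lt
  rw [Tree.r_mk, h] at this
  exact Multiset.card_eq_zero.1 (Nat.lt_one_iff.1 this)

/-- Attaching a leaf at the root adds a one-vertex branch. -/
theorem branches_attach_root (hr : v = u.root) {τ : Tree} (hτ : τ.branches = 0) :
    (u.attach v hv L hL).branches = τ ::ₘ u.branches := by
  subst hr
  have hLm : L ∈ (u.attach u.root hv L hL).V := mem_attach_V.2 (Or.inl rfl)
  let c : Option (u.children u.root) → (u.attach u.root hv L hL).V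
    | none => ⟨L, hLm⟩
    | some x => ⟨x.1, mem_attach_of_mem x.1.2⟩
  have hne : ∀ x : u.children u.root, ((x.1 : ℤ)) ≠ L := fun x => (hL _ x.1.2).ne
  have hinj : Function.Injective c := by
    rintro (_ | x) (_ | y) h
    · rfl
    · exact absurd (congrArg Subtype.val h).symm (hne y)
    · exact absurd (congrArg Subtype.val h) (hne x)
    · have h' := congrArg Subtype.val h
      exact congrArg some (Subtype.ext (Subtype.ext h'))
  rw [branches_eq_map (u.attach u.root hv L hL) c hinj, branches_eq_univ, univ_option,
    show (Finset.insertNone (Finset.univ : Finset (u.children u.root))).val =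
      none ::ₘ Finset.univ.val.map some from rfl, Multiset.map_cons, Multiset.map_map]
  · congr 1
    -- The subtree at the new leaf has one vertex, hence no branches, which identifies its class
    -- with `τ`.
    · apply Tree.branches_injective
      rw [hτ, Tree.branches_mk]
      apply branches_of_card_eq_one
      rw [Finset.card_eq_one]
      refine ⟨L, Finset.ext fun y => ?_⟩
      rw [mem_subtree, Finset.mem_singleton]
      constructor
      · rintro ⟨h1, h2⟩
        rcases mem_attach_V.1 h1 with h | h
        · exact h
        · exact absurd (hL _ h) (not_lt.2 h2.le)
      · rintro rfl
        exact ⟨hLm, Or.inl rfl⟩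
    · refine Multiset.map_congr rfl fun x _ => congrArg Tree.mk ?_
      exact subtree_attach_of_not_reach _ _ (not_reach_of_child (mem_children.1 x.2))
  · intro x
    rw [root_attach, mem_attach_E]
    constructor
    · rintro (⟨_, h⟩ | h)
      · exact ⟨none, Subtype.ext h.symm⟩
      · exact ⟨some ⟨⟨x, (u.edge_mem _ _ h).2.1⟩, mem_children.2 h⟩, rfl⟩
    · rintro ⟨_ | y, rfl⟩
      · exact Or.inl ⟨rfl, rfl⟩
      · exact Or.inr (mem_children.1 y.2)

/-- Attaching a leaf at a vertex below the child `d` of the root changes only the branch at `d`. -/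
theorem branches_attach (d : u.children u.root) (h : u.Reach d.1 v) :
    (u.attach v hv L hL).branches = (Finset.univ : Finset (u.children u.root)).val.map
      (Function.update (fun c => Tree.mk (u.subtree c.1)) d
        (Tree.mk ((u.subtree d.1).attach v (mem_subtree.2 ⟨hv, h⟩) L
          (fun y hy => hL y (mem_subtree.1 hy).1)))) := by
  let c : u.children u.root → (u.attach v hv L hL).V :=
    fun x => ⟨x.1, mem_attach_of_mem x.1.2⟩
  have hinj : Function.Injective c := by
    intro x y h
    have h' := congrArg Subtype.val h
    exact Subtype.ext (Subtype.ext h')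
  have hvr : (u.root : ℤ) ≠ v := by
    intro h'
    rw [← h'] at h
    exact not_reach_of_child (mem_children.1 d.2) h
  rw [branches_eq_map (u.attach v hv L hL) c hinj]
  · refine Multiset.map_congr rfl fun x _ => ?_
    by_cases hxd : x = d
    · subst hxd
      rw [Function.update_self]
      exact congrArg Tree.mk (subtree_attach_of_reach _ _ h)
    · rw [Function.update_of_ne hxd]
      refine congrArg Tree.mk (subtree_attach_of_not_reach _ _ fun h' => hxd ?_)
      exact Subtype.ext (Subtype.ext
        (child_unique (mem_children.1 x.2) (mem_children.1 d.2) h' h))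
  · intro x
    rw [root_attach, mem_attach_E]
    constructor
    · rintro (⟨h, _⟩ | h)
      · exact absurd h hvr
      · exact ⟨⟨⟨x, (u.edge_mem _ _ h).2.1⟩, mem_children.2 h⟩, rfl⟩
    · rintro ⟨y, rfl⟩
      exact Or.inr (mem_children.1 y.2)

end Attach

/-- A tree is determined by the result of attaching a leaf, as is the vertex it is attached to. -/
theorem attach_injective {u u' : LTree} {v v' L : ℤ} {hv : v ∈ u.V} {hv' : v' ∈ u'.V}
    {hL : ∀ x ∈ u.V, x < L} {hL' : ∀ x ∈ u'.V, x < L}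
    (h : u.attach v hv L hL = u'.attach v' hv' L hL') : u = u' ∧ v = v' := by
  have notMem : ∀ {w : LTree}, (∀ x ∈ w.V, x < L) → L ∉ w.V := fun hw h => lt_irrefl _ (hw _ h)
  have notMemE : ∀ {w : LTree} {a : ℤ}, (∀ x ∈ w.V, x < L) → (a, L) ∉ w.E :=
    fun hw h => notMem hw (LTree.edge_mem _ _ _ h).2.1
  have hvv : v = v' := by
    have : (v, L) ∈ (u'.attach v' hv' L hL').E := h ▸ mem_attach_E.2 (Or.inl ⟨rfl, rfl⟩)
    rcases mem_attach_E.1 this with h | h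
    · exact h.1
    · exact absurd h (notMemE hL')
  refine ⟨?_, hvv⟩
  have hV := congrArg (fun w => w.V.erase L) h
  have hE := congrArg (fun w => w.E.erase (v, L)) h
  subst hvv
  simp only [attach, Finset.erase_insert (notMem hL), Finset.erase_insert (notMem hL'),
    Finset.erase_insert (notMemE hL), Finset.erase_insert (notMemE hL')] at hV hE
  exact LTree.ext hV hE

/-- Every tree with more than one vertex arises by attaching its vertex of largest label. -/
theorem exists_eq_attach (w : LTree) (L : ℤ) (hLw : L ∈ w.V) (hmax : ∀ x ∈ w.V, x ≤ L)
    (hr : L ≠ w.root) :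
    ∃ (u : LTree) (v : ℤ) (hv : v ∈ u.V) (hL : ∀ x ∈ u.V, x < L), w = u.attach v hv L hL := by
  obtain ⟨v, -, he⟩ := (w.path_root hLw hr).last
  have hvL := (w.edge_mem _ _ he).2.2
  have hroot : (w.root : ℤ) ∈ w.V.erase L := Finset.mem_erase.2 ⟨hr.symm, w.root.2⟩
  have hE : ∀ {a b : ℤ}, (a, b) ∈ w.E.erase (v, L) ↔ (a, b) ∈ w.E ∧ b ≠ L := by
    intro a b
    rw [Finset.mem_erase, and_comm]
    -- As `v` is the only parent of `L`, erasing the single edge `(v, L)` removes all edges into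
    -- `L`.
    refine and_congr_right fun h => not_congr ⟨fun h' => (Prod.mk.inj h').2, ?_⟩
    rintro rfl
    rw [w.parent_unique _ _ _ h he]
  have hpath : ∀ {x y : ℤ}, w.Path x y → y ≠ L →
      Relation.TransGen (fun a b => (a, b) ∈ w.E.erase (v, L)) x y := by
    intro x y h hy
    induction h with
    | single e => exact .single (hE.2 ⟨e, hy⟩)
    | tail hp e ih =>
      have := w.edge_mem _ _ e
      exact (ih ((this.2.2.trans_le (hmax _ this.2.1)).ne)).tail (hE.2 ⟨e, hy⟩)
  let u : LTree :=
    { V := w.V.erase L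
      E := w.E.erase (v, L)
      nonempty := ⟨_, hroot⟩
      edge_mem := by
        intro x y h
        obtain ⟨h, hy⟩ := hE.1 h
        have := w.edge_mem x y h
        exact ⟨Finset.mem_erase.2 ⟨(this.2.2.trans_le (hmax _ this.2.1)).ne, this.1⟩,
          Finset.mem_erase.2 ⟨hy, this.2.1⟩, this.2.2⟩
      parent_unique := fun x x' y h h' => w.parent_unique x x' y (hE.1 h).1 (hE.1 h').1
      connected := by
        intro x hx y hy hxy
        obtain ⟨hx, hx'⟩ := Finset.mem_erase.1 hx
        obtain ⟨hy, hy'⟩ := Finset.mem_erase.1 hy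
        rcases w.connected x hx' y hy' hxy with h | h | ⟨z, hz, hzx, hzy, h1, h2⟩
        · exact Or.inl (hpath h hy)
        · exact Or.inr (Or.inl (hpath h hx))
        · refine Or.inr (Or.inr ⟨z, Finset.mem_erase.2 ⟨?_, hz⟩, hzx, hzy, hpath h1 hx,
            hpath h2 hy⟩)
          rintro rfl
          exact absurd (Path.lt h1) (not_lt.2 (hmax _ hx')) }
  refine ⟨u, v, Finset.mem_erase.2 ⟨hvL.ne, (w.edge_mem _ _ he).1⟩, fun x hx => ?_, ?_⟩
  · obtain ⟨h1, h2⟩ := Finset.mem_erase.1 hx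
    exact lt_of_le_of_ne (hmax _ h2) h1
  · exact LTree.ext (Finset.insert_erase hLw).symm (Finset.insert_erase he).symm

/-- Attaching leaves is compatible with isomorphisms. -/
theorem attach_iso {u u' : LTree} (φ : u.V ≃ u'.V)
    (hφ : ∀ x y : u.V, ((x : ℤ), (y : ℤ)) ∈ u.E ↔ ((φ x : ℤ), (φ y : ℤ)) ∈ u'.E)
    (v : u.V) {L L' : ℤ} (hL : ∀ x ∈ u.V, x < L) (hL' : ∀ x ∈ u'.V, x < L') :
    Iso (u.attach v v.2 L hL) (u'.attach (φ v) (φ v).2 L' hL') := by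
  -- The vertices of the enlarged tree are the old ones and one more, whatever its label; an
  -- isomorphism therefore extends by sending new leaf to new leaf.
  have dec : ∀ (w : LTree) (v : w.V) (M : ℤ) (hM : ∀ x ∈ w.V, x < M),
      ∃ e : Option w.V ≃ (w.attach v v.2 M hM).V, (e none : ℤ) = M ∧ ∀ x, (e (some x) : ℤ) = x := by
    intro w v M hM
    refine ⟨Equiv.ofBijective (fun o => match o with
      | none => ⟨M, mem_attach_V.2 (Or.inl rfl)⟩
      | some x => ⟨x, mem_attach_of_mem x.2⟩) ⟨?_, ?_⟩, rfl, fun _ => rfl⟩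
    · rintro (_ | x) (_ | y) h
      · rfl
      · exact absurd (congrArg Subtype.val h).symm (hM _ y.2).ne
      · exact absurd (congrArg Subtype.val h) (hM _ x.2).ne
      · have h' := congrArg Subtype.val h
        exact congrArg some (Subtype.ext h')
    · rintro ⟨x, hx⟩
      rcases mem_attach_V.1 hx with h | h
      · exact ⟨none, Subtype.ext h.symm⟩
      · exact ⟨some ⟨x, h⟩, rfl⟩
  obtain ⟨e, he0, he⟩ := dec u v L hL
  obtain ⟨e', he0', he'⟩ := dec u' (φ v) L' hL'
  have nE : ∀ (w : LTree) (M : ℤ), (∀ x ∈ w.V, x < M) → ∀ a, (a, M) ∉ w.E ∧ (M, a) ∉ w.E :=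
    fun w M hM a => ⟨fun h => lt_irrefl _ (hM _ (w.edge_mem _ _ h).2.1),
      fun h => lt_irrefl _ (hM _ (w.edge_mem _ _ h).1)⟩
  refine ⟨(e.symm.trans (Equiv.optionCongr φ)).trans e', fun x y => ?_⟩
  obtain ⟨x, rfl⟩ := e.surjective x
  obtain ⟨y, rfl⟩ := e.surjective y
  have h1 : L ≠ (v : ℤ) := (hL _ v.2).ne'
  have h2 : L' ≠ (φ v : ℤ) := (hL' _ (φ v).2).ne'
  have h3 : ∀ x : u.V, (x : ℤ) ≠ L := fun x => (hL _ x.2).ne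
  have h4 : ∀ x : u'.V, (x : ℤ) ≠ L' := fun x => (hL' _ x.2).ne
  simp only [mem_attach_E, Equiv.trans_apply, Equiv.symm_apply_apply, Equiv.optionCongr_apply]
  rcases x with _ | x <;> rcases y with _ | y <;>
    simp [he0, he, he0', he', h1, h2, h3, h4, nE u L hL, nE u' L' hL', hφ]

end LTree

/-! ### The bijection between trees and multisets of trees. -/

theorem map_update_univ {ι β : Type*} [Fintype ι] [DecidableEq ι] (f : ι → β) (d : ι) (b : β) :
    (Finset.univ : Finset ι).val.map (Function.update f d b) =
      b ::ₘ ((Finset.univ : Finset ι).erase d).val.map f := by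
  conv_lhs => rw [← Finset.insert_erase (Finset.mem_univ d)]
  rw [Finset.insert_val_of_notMem (Finset.notMem_erase d _), Multiset.map_cons,
    Function.update_self]
  congr 1
  exact Multiset.map_congr rfl fun x hx => Function.update_of_ne (Finset.ne_of_mem_erase hx) _ _

namespace LTree

/-- The tree with the single vertex `0`. -/
def single : LTree where
  V := {0}
  E := ∅
  nonempty := ⟨0, by simp⟩
  edge_mem := by simp
  parent_unique := by simp
  connected := by
    intro x hx y hy hxy
    simp only [Finset.mem_singleton] at hx hy
    exact absurd (hx.trans hy.symm) hxy

/-- A label larger than all labels of `u`. -/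
def top (u : LTree) : ℤ := u.V.max' u.nonempty + 1

theorem lt_top (u : LTree) (x : ℤ) (hx : x ∈ u.V) : x < u.top :=
  Int.lt_add_one_of_le (u.V.le_max' x hx)

/-- Attach a leaf with the next larger label. -/
def attachTop (u : LTree) (v : u.V) : LTree := u.attach v v.2 u.top u.lt_top

/-- The vertex of largest label is either the root, and then the only vertex, or a removable leaf.
This drives the induction in `branches_surjective`. -/
theorem exists_eq_attachTop_or (w : LTree) : w.V.card = 1 ∨
    ∃ (u : LTree) (v : u.V), u.V.card < w.V.card ∧ Iso w (u.attachTop v) := by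
  by_cases h : w.V.max' w.nonempty = w.root
  · left
    rw [Finset.card_eq_one]
    refine ⟨w.root, Finset.eq_singleton_iff_unique_mem.2 ⟨w.root.2, fun x hx => ?_⟩⟩
    exact le_antisymm ((w.V.le_max' x hx).trans h.le) (w.root_le hx)
  · right
    obtain ⟨u, v, hv, hL, hw⟩ := w.exists_eq_attach _ (w.V.max'_mem w.nonempty)
      (fun x hx => w.V.le_max' x hx) h
    refine ⟨u, ⟨v, hv⟩, ?_, ?_⟩
    · rw [hw, card_attach]
      exact Nat.lt_succ_self _
    · rw [hw]
      exact attach_iso (Equiv.refl _) (fun _ _ => Iff.rfl) ⟨v, hv⟩ hL u.lt_top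

end LTree

namespace Tree

/-- The one-vertex tree. -/
def τ : Tree := Tree.mk LTree.single

theorem branches_eq_zero_of_r (t : Tree) (h : t.r = 1) : t.branches = 0 := by
  have := t.card_branches_lt
  rw [h] at this
  exact Multiset.card_eq_zero.1 (Nat.lt_one_iff.1 this)

theorem branches_τ : τ.branches = 0 := branches_eq_zero_of_r _ rfl

theorem eq_τ_of_r (t : Tree) (h : t.r = 1) : t = τ :=
  branches_injective ((t.branches_eq_zero_of_r h).trans branches_τ.symm)

/-- Induction on the total number of vertices in the multiset, removing one leaf from one member. If
that member is a single vertex, it is restored by a leaf at the root; otherwise a leaf is attached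
inside the branch that realises the smaller member. Growing by leaves avoids gluing trees with
disjoint labels. -/
theorem branches_surjective : Function.Surjective branches := by
  have main : ∀ n, ∀ p : Multiset Tree, (p.map r).sum = n → ∃ t, branches t = p := by
    intro n
    induction n using Nat.strong_induction_on with
    | _ n ih =>
      intro p hp
      induction p using Multiset.induction_on with
      | empty => exact ⟨τ, branches_τ⟩
      | cons t q _ =>
        rw [Multiset.map_cons, Multiset.sum_cons] at hp
        obtain ⟨w, rfl⟩ := t.exists_mk
        rcases w.exists_eq_attachTop_or with h1 | ⟨w', v, hlt, hiso⟩
        · have ht := eq_τ_of_r (Tree.mk w) h1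
          obtain ⟨t', ht'⟩ := ih _ (by have := (Tree.mk w).r_pos; omega) q rfl
          obtain ⟨u, rfl⟩ := t'.exists_mk
          refine ⟨Tree.mk (u.attachTop u.root), ?_⟩
          rw [branches_mk, LTree.attachTop, LTree.branches_attach_root rfl branches_τ, ht,
            ← branches_mk, ht']
        · obtain ⟨t', ht'⟩ := ih ((Tree.mk w').r + (q.map r).sum)
            (by rw [r_mk] at hp ⊢; omega) (Tree.mk w' ::ₘ q) (by simp)
          obtain ⟨u, rfl⟩ := t'.exists_mk
          rw [branches_mk, LTree.branches_eq_univ] at ht'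
          have hmem : Tree.mk w' ∈ (Finset.univ : Finset (u.children u.root)).val.map
              fun c => Tree.mk (u.subtree c.1) := by
            rw [ht']
            exact Multiset.mem_cons_self _ _
          obtain ⟨d, -, hd⟩ := Multiset.mem_map.1 hmem
          obtain ⟨φ, hφ⟩ := mk_eq_iff.1 hd.symm
          have hv := LTree.mem_subtree.1 (φ v).2
          refine ⟨Tree.mk (u.attach (φ v) hv.1 u.top u.lt_top), ?_⟩
          rw [branches_mk, LTree.branches_attach d hv.2, map_update_univ]
          -- The branches other than the one at `d` are found by cancelling the class of `w'` on
          -- both sides of `ht'`.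
          have hq : ((Finset.univ : Finset (u.children u.root)).erase d).val.map
              (fun c => Tree.mk (u.subtree c.1)) = q := by
            rw [← Function.update_eq_self d fun c : u.children u.root => Tree.mk (u.subtree c.1),
              map_update_univ, hd] at ht'
            exact (Multiset.cons_inj_right _).1 ht'
          rw [hq]
          congr 1
          refine mk_eq_iff.2 (LTree.Iso.trans (LTree.Iso.symm ?_) (LTree.Iso.symm hiso))
          exact LTree.attach_iso φ hφ v _ _
  intro p
  exact main _ p rfl

/-- Non-labelled trees correspond to multisets of non-labelled trees. -/
def branchesEquiv : Tree ≃ Multiset Tree :=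
  Equiv.ofBijective branches ⟨branches_injective, branches_surjective⟩

end Tree

/-! ### Labelled trees on an initial segment, and the numbers `α(t)`. -/

namespace LTree

theorem finite_labelled (n : ℕ) : {u : LTree | u.V = Finset.Ico 0 (n : ℤ)}.Finite := by
  refine Set.Finite.of_injOn (f := LTree.E) (t := {E | E ⊆ Finset.Ico 0 (n : ℤ) ×ˢ Finset.Ico 0 (n : ℤ)})
    ?_ ?_ ?_
  · rintro u (hu : u.V = _) ⟨a, b⟩ h
    have := u.edge_mem a b h
    rw [hu] at this
    exact Finset.mem_product.2 ⟨this.1, this.2.1⟩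
  · intro u hu v hv h
    exact LTree.ext (Eq.trans hu (Eq.symm hv)) h
  · refine (Finset.finite_toSet (Finset.powerset (Finset.Ico 0 (n : ℤ) ×ˢ Finset.Ico 0 (n : ℤ)))).subset
      fun E hE => ?_
    exact Finset.mem_coe.2 (Finset.mem_powerset.2 hE)

/-- The labelled trees with vertices `0, …, n - 1`. -/
def labelled (n : ℕ) : Finset LTree := (finite_labelled n).toFinset

theorem mem_labelled {n : ℕ} {u : LTree} : u ∈ labelled n ↔ u.V = Finset.Ico 0 (n : ℤ) := by
  simp [labelled]

theorem card_of_mem_labelled {n : ℕ} {u : LTree} (h : u ∈ labelled n) : u.V.card = n := by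
  rw [mem_labelled.1 h]
  simp

theorem labelled_one : labelled 1 = {single} := by
  ext u
  rw [mem_labelled, Finset.mem_singleton]
  have h01 : Finset.Ico (0 : ℤ) ((1 : ℕ) : ℤ) = {0} := rfl
  rw [h01]
  constructor
  · intro h
    refine LTree.ext h (Finset.eq_empty_of_forall_notMem ?_)
    rintro ⟨a, b⟩ hab
    have := u.edge_mem a b hab
    rw [h, Finset.mem_singleton, Finset.mem_singleton] at this
    omega
  · rintro rfl
    rfl

theorem top_of_mem_labelled {n : ℕ} {u : LTree} (h : u ∈ labelled n) : u.top = n := by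
  rw [mem_labelled] at h
  have h1 := u.V.max'_mem u.nonempty
  rw [top]
  set M := u.V.max' u.nonempty with hM
  have h2 : ∀ x ∈ u.V, x ≤ M := fun x hx => u.V.le_max' x hx
  rw [h, Finset.mem_Ico] at h1
  have h3 := h2 (n - 1) (by rw [h, Finset.mem_Ico]; omega)
  omega

/-- The labelled trees with `n + 1` vertices arise uniquely from those with `n` vertices by
attaching a leaf. -/
theorem sum_labelled_succ {M : Type*} [AddCommMonoid M] (n : ℕ) (hn : 1 ≤ n) (f : LTree → M) :
    ∑ w ∈ labelled (n + 1), f w = ∑ u ∈ labelled n, ∑ v : u.V, f (u.attachTop v) := by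
  rw [Finset.sum_sigma']
  symm
  refine Finset.sum_bij (fun p _ => p.1.attachTop p.2) ?_ ?_ ?_ fun _ _ => rfl
  · rintro ⟨u, v⟩ h
    have hu := (Finset.mem_sigma.1 h).1
    rw [mem_labelled]
    ext x
    rw [attachTop, mem_attach_V, top_of_mem_labelled hu, mem_labelled.1 hu, Finset.mem_Ico,
      Finset.mem_Ico]
    push_cast
    omega
  · rintro ⟨u, v⟩ h ⟨u', v'⟩ h' heq
    have hu := (Finset.mem_sigma.1 h).1
    have hu' := (Finset.mem_sigma.1 h').1
    have htop : u.top = u'.top := (top_of_mem_labelled hu).trans (top_of_mem_labelled hu').symm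
    have hlt : ∀ x ∈ u'.V, x < u.top := fun x hx => htop ▸ u'.lt_top x hx
    have heq' : u.attach v v.2 u.top u.lt_top = u'.attach v' v'.2 u.top hlt := by
      rw [show u.attach v v.2 u.top u.lt_top = u'.attach v' v'.2 u'.top u'.lt_top from heq]
      congr 1
      exact htop.symm
    obtain ⟨rfl, h2⟩ := attach_injective heq'
    rw [Subtype.ext h2]
  · intro w hw
    have hV := mem_labelled.1 hw
    have hnw : (n : ℤ) ∈ w.V := by
      rw [hV, Finset.mem_Ico]
      push_cast
      omega
    have hmax : ∀ x ∈ w.V, x ≤ n := by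
      intro x hx
      rw [hV, Finset.mem_Ico] at hx
      push_cast at hx
      omega
    -- The hypothesis `1 ≤ n` is needed here: the one-vertex tree does not arise by attaching a
    -- leaf.
    have hroot : (n : ℤ) ≠ w.root := by
      have h0 : (0 : ℤ) ∈ w.V := by
        rw [hV, Finset.mem_Ico]
        omega
      have := w.root_le h0
      omega
    obtain ⟨u, v, hv, hL, rfl⟩ := w.exists_eq_attach n hnw hmax hroot
    have hu : u ∈ labelled n := by
      rw [mem_labelled]
      ext x
      have h1 := congrArg (fun S : Finset ℤ => x ∈ S) hV
      simp only [mem_attach_V, Finset.mem_Ico, eq_iff_iff] at h1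
      rw [Finset.mem_Ico]
      push_cast at h1
      constructor
      · intro h
        have := hL x h
        have := h1.1 (Or.inr h)
        omega
      · intro h
        have := h1.2 (by omega)
        rcases this with h' | h'
        · omega
        · exact h'
    refine ⟨⟨u, ⟨v, hv⟩⟩, Finset.mem_sigma.2 ⟨hu, Finset.mem_univ _⟩, ?_⟩
    have htop := top_of_mem_labelled hu
    simp only [attachTop]
    congr 1

/-- Change the labels of a tree by a strictly increasing function. -/
def relabel (u : LTree) (f : ℤ → ℤ) (hf : StrictMonoOn f u.V) : LTree where
  V := u.V.image f
  E := u.E.image (Prod.map f f)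
  nonempty := u.nonempty.image f
  edge_mem := by
    intro x y h
    obtain ⟨⟨a, b⟩, hab, h⟩ := Finset.mem_image.1 h
    obtain ⟨rfl, rfl⟩ := Prod.mk.inj h
    have := u.edge_mem a b hab
    exact ⟨Finset.mem_image_of_mem _ this.1, Finset.mem_image_of_mem _ this.2.1,
      hf this.1 this.2.1 this.2.2⟩
  parent_unique := by
    intro x x' y h h'
    obtain ⟨⟨a, b⟩, hab, h⟩ := Finset.mem_image.1 h
    obtain ⟨rfl, rfl⟩ := Prod.mk.inj h
    obtain ⟨⟨a', b'⟩, hab', h⟩ := Finset.mem_image.1 h'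
    obtain ⟨rfl, h3⟩ := Prod.mk.inj h
    have e := u.edge_mem a b hab
    have e' := u.edge_mem a' b' hab'
    obtain rfl := hf.injOn e'.2.1 e.2.1 h3
    rw [u.parent_unique _ _ _ hab hab']
  connected := by
    have lift : ∀ {a b : ℤ}, Relation.TransGen (fun a b => (a, b) ∈ u.E) a b →
        Relation.TransGen (fun a b => (a, b) ∈ u.E.image (Prod.map f f)) (f a) (f b) :=
      fun h => Relation.TransGen.lift f
        (fun a b hab => Finset.mem_image_of_mem (Prod.map f f) hab) _ _ h
    intro x hx y hy hxy
    obtain ⟨a, ha, rfl⟩ := Finset.mem_image.1 hx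
    obtain ⟨b, hb, rfl⟩ := Finset.mem_image.1 hy
    have hab : a ≠ b := fun h => hxy (h ▸ rfl)
    rcases u.connected a ha b hb hab with h | h | ⟨z, hz, hza, hzb, h1, h2⟩
    · exact Or.inl (lift h)
    · exact Or.inr (Or.inl (lift h))
    · exact Or.inr (Or.inr ⟨f z, Finset.mem_image_of_mem _ hz,
        fun h => hza (hf.injOn hz ha h), fun h => hzb (hf.injOn hz hb h), lift h1, lift h2⟩)

theorem relabel_iso (u : LTree) (f : ℤ → ℤ) (hf : StrictMonoOn f u.V) : Iso u (u.relabel f hf) := by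
  refine ⟨Equiv.ofBijective (fun x => ⟨f x, Finset.mem_image_of_mem _ x.2⟩) ⟨?_, ?_⟩, ?_⟩
  · intro x y h
    exact Subtype.ext (hf.injOn x.2 y.2 (Subtype.ext_iff.1 h))
  · rintro ⟨y, hy⟩
    obtain ⟨x, hx, rfl⟩ := Finset.mem_image.1 hy
    exact ⟨⟨x, hx⟩, rfl⟩
  · intro x y
    constructor
    · exact fun h => Finset.mem_image_of_mem (Prod.map f f) h
    · intro h
      obtain ⟨⟨a, b⟩, hab, h⟩ := Finset.mem_image.1 h
      obtain ⟨h1, h2⟩ := Prod.mk.inj h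
      have := u.edge_mem a b hab
      rw [← hf.injOn this.1 x.2 h1, ← hf.injOn this.2.1 y.2 h2]
      exact hab

theorem relabel_relabel (u : LTree) (f g : ℤ → ℤ) (hf : StrictMonoOn f u.V)
    (hg : StrictMonoOn g (u.relabel f hf).V) (h : ∀ x ∈ u.V, g (f x) = x) :
    (u.relabel f hf).relabel g hg = u := by
  apply LTree.ext
  · show (u.V.image f).image g = u.V
    rw [Finset.image_image]
    exact (Finset.image_congr fun x hx => h x hx).trans Finset.image_id
  · show (u.E.image (Prod.map f f)).image (Prod.map g g) = u.E
    rw [Finset.image_image]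
    refine (Finset.image_congr ?_).trans Finset.image_id
    rintro ⟨a, b⟩ hab
    have := u.edge_mem a b hab
    exact Prod.ext (h a this.1) (h b this.2.1)

end LTree

/-- Serves to move labelled trees from the vertex set of a chosen representative to `0, …, r(t) - 1`
and back, keeping edges increasing. -/
theorem exists_strictMonoOn_inverse {S T : Finset ℤ} (h : S.card = T.card) :
    ∃ f g : ℤ → ℤ, StrictMonoOn f S ∧ StrictMonoOn g T ∧ S.image f = T ∧ T.image g = S ∧
      (∀ x ∈ S, g (f x) = x) ∧ ∀ x ∈ T, f (g x) = x := by
  let e : S ≃o T := (S.orderIsoOfFin rfl).symm.trans (T.orderIsoOfFin h.symm)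
  let f : ℤ → ℤ := fun x => if hx : x ∈ S then e ⟨x, hx⟩ else 0
  let g : ℤ → ℤ := fun x => if hx : x ∈ T then e.symm ⟨x, hx⟩ else 0
  have hf : ∀ x (hx : x ∈ S), f x = e ⟨x, hx⟩ := fun x hx => dif_pos hx
  have hg : ∀ x (hx : x ∈ T), g x = e.symm ⟨x, hx⟩ := fun x hx => dif_pos hx
  have hfT : ∀ x ∈ S, f x ∈ T := fun x hx => by rw [hf x hx]; exact (e _).2
  have hgS : ∀ x ∈ T, g x ∈ S := fun x hx => by rw [hg x hx]; exact (e.symm _).2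
  have hgf : ∀ x ∈ S, g (f x) = x := fun x hx => by
    rw [hg _ (hfT x hx)]
    simp [hf x hx]
  have hfg : ∀ x ∈ T, f (g x) = x := fun x hx => by
    rw [hf _ (hgS x hx)]
    simp [hg x hx]
  refine ⟨f, g, ?_, ?_, ?_, ?_, hgf, hfg⟩
  · intro x hx y hy hxy
    rw [hf x hx, hf y hy]
    exact e.strictMono (show (⟨x, hx⟩ : S) < ⟨y, hy⟩ from hxy)
  · intro x hx y hy hxy
    rw [hg x hx, hg y hy]
    exact e.symm.strictMono (show (⟨x, hx⟩ : T) < ⟨y, hy⟩ from hxy)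
  · ext y
    rw [Finset.mem_image]
    exact ⟨fun ⟨x, hx, h⟩ => h ▸ hfT x hx, fun hy => ⟨g y, hgS y hy, hfg y hy⟩⟩
  · ext y
    rw [Finset.mem_image]
    exact ⟨fun ⟨x, hx, h⟩ => h ▸ hgS x hx, fun hy => ⟨f y, hfT y hy, hgf y hy⟩⟩

/-- `α(t)` counts the labelled trees with vertices `0, …, r(t) - 1` and isomorphism class `t`. -/
theorem Tree.α_eq (t : Tree) : t.α = ((LTree.labelled t.r).filter fun u => Tree.mk u = t).card := by
  obtain ⟨w, hw⟩ : ∃ w : LTree, w = Quotient.out t := ⟨_, rfl⟩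
  have hwt : Tree.mk w = t := by
    rw [hw]
    exact Quotient.out_eq t
  have hcard : w.V.card = (Finset.Ico 0 (t.r : ℤ)).card := by
    rw [← hwt, r_mk]
    simp
  obtain ⟨f, g, hf, hg, hfV, hgV, hgf, hfg⟩ := exists_strictMonoOn_inverse hcard
  rw [α, ← hw, ← Fintype.card_coe, ← Nat.card_eq_fintype_card]
  have hf' : ∀ {u : LTree}, u.V = w.V → StrictMonoOn f u.V := fun h => h ▸ hf
  have hg' : ∀ {u : LTree}, u.V = Finset.Ico 0 (t.r : ℤ) → StrictMonoOn g u.V := fun h => h ▸ hg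
  -- Increasing relabelling preserves the isomorphism class and is inverted by the inverse
  -- relabelling, so it matches the two families being counted.
  refine Nat.card_congr ⟨fun u => ⟨u.1.relabel f (hf' u.2.1), ?_⟩, fun u => ⟨u.1.relabel g
    (hg' (LTree.mem_labelled.1 (Finset.mem_filter.1 u.2).1)), ?_⟩, fun u => Subtype.ext
    (LTree.relabel_relabel _ f g (hf' u.2.1) (hg' ?_) fun x hx => ?_), fun u => Subtype.ext
    (LTree.relabel_relabel _ g f (hg' (LTree.mem_labelled.1 (Finset.mem_filter.1 u.2).1))
      (hf' ?_) fun x hx => ?_)⟩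
  · refine Finset.mem_filter.2 ⟨LTree.mem_labelled.2 ?_, ?_⟩
    · show u.1.V.image f = _
      rw [u.2.1, hfV]
    · rw [← hwt]
      exact mk_eq_iff.2 ((u.1.relabel_iso f _).symm.trans u.2.2)
  · obtain ⟨h1, h2⟩ := Finset.mem_filter.1 u.2
    rw [LTree.mem_labelled] at h1
    refine ⟨?_, ?_⟩
    · show u.1.V.image g = _
      rw [h1, hgV]
    · exact (u.1.relabel_iso g _).symm.trans (mk_eq_iff.1 (h2.trans hwt.symm))
  · show u.1.V.image f = _
    rw [u.2.1, hfV]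
  · exact hgf x (u.2.1 ▸ hx)
  · show u.1.V.image g = _
    rw [LTree.mem_labelled.1 (Finset.mem_filter.1 u.2).1, hgV]
  · exact hfg x (LTree.mem_labelled.1 (Finset.mem_filter.1 u.2).1 ▸ hx)

/-- Sums over non-labelled trees weighted by `α` are sums over labelled trees. -/
theorem sum_upTo_α {M : Type*} [AddCommMonoid M] [Module ℝ M] (m : ℕ) (c : ℕ → ℝ) (F : Tree → M) :
    ∑ t ∈ Tree.upTo m, (c t.r * (t.α : ℝ)) • F t =
      ∑ n ∈ Finset.range (m + 1), c n • ∑ u ∈ LTree.labelled n, F (Tree.mk u) := by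
  have h1 : ∀ t ∈ Tree.upTo m, (c t.r * (t.α : ℝ)) • F t =
      ∑ u ∈ (LTree.labelled t.r).filter fun u => Tree.mk u = t, c t.r • F (Tree.mk u) := by
    intro t _
    rw [Finset.sum_congr rfl fun u hu => by rw [(Finset.mem_filter.1 hu).2], Finset.sum_const,
      ← Tree.α_eq, mul_comm, mul_smul, Nat.cast_smul_eq_nsmul]
  rw [Finset.sum_congr rfl h1, Finset.sum_congr rfl fun n _ => Finset.smul_sum,
    Finset.sum_sigma', Finset.sum_sigma']
  -- Pairs (class, representative) are reindexed by (order, representative); the class is recovered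
  -- from the representative.
  refine Finset.sum_bij (fun p _ => ⟨p.1.r, p.2⟩) ?_ ?_ ?_ fun p hp => ?_
  · rintro ⟨t, u⟩ h
    simp only [Finset.mem_sigma, Finset.mem_filter, Tree.upTo, Set.Finite.mem_toFinset,
      Set.mem_ofPred_eq, Finset.mem_range] at h ⊢
    exact ⟨by omega, h.2.1⟩
  · rintro ⟨t, u⟩ h ⟨t', u'⟩ h' heq
    simp only [Finset.mem_sigma, Finset.mem_filter] at h h'
    simp only [Sigma.mk.injEq, heq_eq_eq] at heq
    obtain ⟨-, rfl⟩ := heq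
    rw [← h.2.2, ← h'.2.2]
  · rintro ⟨n, u⟩ h
    simp only [Finset.mem_sigma, Finset.mem_range] at h
    have hr : (Tree.mk u).r = n := LTree.card_of_mem_labelled h.2
    refine ⟨⟨Tree.mk u, u⟩, ?_, ?_⟩
    · simp only [Finset.mem_sigma, Finset.mem_filter, Tree.upTo, Set.Finite.mem_toFinset,
        Set.mem_ofPred_eq, and_true, hr]
      exact ⟨by omega, h.2⟩
    · simp [hr]
  · rfl

/-! ### Symmetry of iterated derivatives. -/

section Symmetry

open Equiv

variable {E F : Type*} [NormedAddCommGroup E] [NormedSpace ℝ E] [NormedAddCommGroup F]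
  [NormedSpace ℝ F] {f : E → F}

theorem differentiable_iteratedFDeriv (hf : ContDiff ℝ ((⊤ : ℕ∞) : WithTop ℕ∞) f) (n : ℕ) :
    Differentiable ℝ (iteratedFDeriv ℝ n f) :=
  hf.differentiable_iteratedFDeriv (by exact_mod_cast ENat.natCast_lt_top n)

theorem contDiff_iteratedFDeriv (hf : ContDiff ℝ ((⊤ : ℕ∞) : WithTop ℕ∞) f) (n : ℕ) :
    ContDiff ℝ 2 (iteratedFDeriv ℝ n f) :=
  hf.iteratedFDeriv_right (WithTop.coe_le_coe.2 (le_top : (2 + n : ℕ∞) ≤ ⊤))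

/-- Swapping the first two arguments is the symmetry of the second derivative of `iteratedFDeriv ℝ n
f`. A later adjacent swap does not touch the first argument, so the identity for the lower
derivative is differentiated in that direction. -/
theorem iteratedFDeriv_comp_swap (hf : ContDiff ℝ ((⊤ : ℕ∞) : WithTop ℕ∞) f) (n : ℕ) (i : Fin n)
    (x : E) (v : Fin (n + 1) → E) :
    iteratedFDeriv ℝ (n + 1) f x (v ∘ swap i.castSucc i.succ) = iteratedFDeriv ℝ (n + 1) f x v := by
  induction n generalizing x with
  | zero => exact i.elim0
  | succ n ih =>
    have hd := fun y => (differentiable_iteratedFDeriv hf (n + 1)) y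
    refine Fin.cases ?_ (fun j => ?_) i
    · have h2 : ∀ w : Fin (n + 2) → E, iteratedFDeriv ℝ (n + 2) f x w =
          fderiv ℝ (fderiv ℝ (iteratedFDeriv ℝ n f)) x (w 0) (w 1) (Fin.tail (Fin.tail w)) := by
        intro w
        have h3 : (fun y => iteratedFDeriv ℝ (n + 1) f y (Fin.tail w)) =
            fun y => fderiv ℝ (iteratedFDeriv ℝ n f) y (w 1) (Fin.tail (Fin.tail w)) := rfl
        have h4 : DifferentiableAt ℝ (fderiv ℝ (iteratedFDeriv ℝ n f)) x :=
          ((contDiff_iteratedFDeriv hf n).fderiv_right (m := 1) (by norm_num)).differentiable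
            (by norm_num) x
        rw [(hd x).iteratedFDeriv_succ_apply_left', h3]
        have h5 := (h4.hasFDerivAt.clm_apply (hasFDerivAt_const (w 1) x))
        have h6 := h5.continuousMultilinear_apply_const (Fin.tail (Fin.tail w))
        rw [h6.fderiv]
        simp
      rw [h2, h2]
      have hs : IsSymmSndFDerivAt ℝ (iteratedFDeriv ℝ n f) x :=
        (contDiff_iteratedFDeriv hf n).contDiffAt.isSymmSndFDerivAt (by simp)
      have e0 : (v ∘ swap (Fin.castSucc (0 : Fin (n + 1))) (Fin.succ 0)) 0 = v 1 := by
        simp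
      have e1 : (v ∘ swap (Fin.castSucc (0 : Fin (n + 1))) (Fin.succ 0)) 1 = v 0 := by
        simp
      have e2 : Fin.tail (Fin.tail (v ∘ swap (Fin.castSucc (0 : Fin (n + 1))) (Fin.succ 0))) =
          Fin.tail (Fin.tail v) := by
        ext k
        simp only [Fin.tail, Function.comp_apply]
        rw [swap_apply_of_ne_of_ne]
        · exact Fin.succ_ne_zero _
        · intro h
          exact Fin.succ_ne_zero _ (Fin.succ_injective _ h)
      rw [e0, e1, e2, hs.eq]
    · rw [(hd x).iteratedFDeriv_succ_apply_left', (hd x).iteratedFDeriv_succ_apply_left']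
      have e0 : (v ∘ swap (Fin.castSucc j.succ) (Fin.succ j.succ)) 0 = v 0 := by
        rw [Function.comp_apply, swap_apply_of_ne_of_ne]
        · rw [← Fin.succ_castSucc]
          exact (Fin.succ_ne_zero _).symm
        · exact (Fin.succ_ne_zero _).symm
      have e1 : Fin.tail (v ∘ swap (Fin.castSucc j.succ) (Fin.succ j.succ)) =
          Fin.tail v ∘ swap j.castSucc j.succ := by
        ext k
        simp only [Fin.tail, Function.comp_apply]
        rw [← Fin.succ_castSucc, (Fin.succ_injective _).swap_apply]
      rw [e0, e1]
      congr 2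
      ext y
      exact ih j y _

/-- The iterated derivatives of a smooth map are symmetric. -/
theorem iteratedFDeriv_comp_perm (hf : ContDiff ℝ ((⊤ : ℕ∞) : WithTop ℕ∞) f) {n : ℕ}
    (x : E) (v : Fin n → E) (σ : Perm (Fin n)) :
    iteratedFDeriv ℝ n f x (v ∘ σ) = iteratedFDeriv ℝ n f x v := by
  cases n with
  | zero => exact congrArg _ (Subsingleton.elim _ _)
  | succ n =>
    have hσ : σ ∈ Submonoid.closure (Set.range fun i : Fin n => swap i.castSucc i.succ) := by
      rw [Equiv.Perm.mclosure_swap_castSucc_succ]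
      trivial
    induction hσ using Submonoid.closure_induction generalizing v with
    | mem σ h =>
      obtain ⟨i, rfl⟩ := h
      exact iteratedFDeriv_comp_swap hf n i x v
    | one => rfl
    | mul σ σ' _ _ h h' =>
      rw [Perm.coe_mul, ← Function.comp_assoc, h', h]

end Symmetry

/-! ### Elementary differentials and their derivatives along the vector field. -/

section Differentials

variable {N : ℕ} {W : EuclideanSpace ℝ (Fin N) → EuclideanSpace ℝ (Fin N)}

/-- The elementary differential, computed from any enumeration of the branches. -/
theorem D_eq (hW : ContDiff ℝ ((⊤ : ℕ∞) : WithTop ℕ∞) W) {l : ℕ} {g : Fin l → Tree} {t : Tree}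
    (h : (Finset.univ : Finset (Fin l)).val.map g = t.branches) (x : EuclideanSpace ℝ (Fin N)) :
    t.D W x = iteratedFDeriv ℝ l W x fun k => (g k).D W x := by
  have h0 : (Finset.univ : Finset (Fin t.branches.toList.length)).val.map t.branches.toList.get =
      t.branches := by
    rw [Fin.univ_val_map, List.ofFn_get, Multiset.coe_toList]
  have hl : l = t.branches.toList.length := by
    rw [Multiset.length_toList, ← h]
    simp
  subst hl
  -- The list chosen in the definition of `D` and the enumeration `g` differ by a permutation,
  -- absorbed by symmetry.
  obtain ⟨e, he⟩ := exists_equiv_of_map_univ_eq (h0.trans h.symm)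
  rw [Tree.D, ← iteratedFDeriv_comp_perm hW x (fun k => (g k).D W x) e]
  congr 1
  ext1 k
  rw [he, Function.comp_apply]

theorem map_univ_comp_equiv {ι κ β : Type*} [Fintype ι] [Fintype κ] (e : ι ≃ κ) (g : κ → β) :
    (Finset.univ : Finset ι).val.map (fun k => g (e k)) = (Finset.univ : Finset κ).val.map g := by
  rw [← Finset.map_univ_equiv e, Finset.map_val, Multiset.map_map]
  rfl

theorem exists_map_univ_eq {α : Type*} (p : Multiset α) : ∃ g : Fin p.card → α,
    (Finset.univ : Finset (Fin p.card)).val.map g = p := by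
  refine ⟨fun k => p.toList.get (k.cast (Multiset.length_toList _).symm), ?_⟩
  refine (map_univ_comp_equiv (finCongr (Multiset.length_toList _).symm) p.toList.get).trans ?_
  rw [Fin.univ_val_map, List.ofFn_get, Multiset.coe_toList]

theorem LTree.mk_attach (u : LTree) (v : u.V) (L : ℤ) (hL : ∀ x ∈ u.V, x < L) :
    Tree.mk (u.attach v v.2 L hL) = Tree.mk (u.attachTop v) :=
  Tree.mk_eq_iff.2 (attach_iso (Equiv.refl _) (fun _ _ => Iff.rfl) v hL u.lt_top)

theorem LTree.sum_vertices {M : Type*} [AddCommMonoid M] (u : LTree) (f : u.V → M) :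
    ∑ v, f v = f u.root + ∑ c : u.children u.root, ∑ v : (u.subtree c.1).V,
      f ⟨v, (mem_subtree.1 v.2).1⟩ := by
  rw [← (Equiv.ofBijective _ u.decomp_bijective).sum_comp, Fintype.sum_option, Fintype.sum_sigma]
  rfl

/-- The derivative of an elementary differential along `W` is the sum of the elementary
differentials of the trees with one more leaf. -/
theorem hasFDerivAt_D (hW : ContDiff ℝ ((⊤ : ℕ∞) : WithTop ℕ∞) W) (u : LTree)
    (x : EuclideanSpace ℝ (Fin N)) :
    ∃ D' : EuclideanSpace ℝ (Fin N) →L[ℝ] EuclideanSpace ℝ (Fin N),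
      HasFDerivAt ((Tree.mk u).D W) D' x ∧
        D' (W x) = ∑ v : u.V, (Tree.mk (u.attachTop v)).D W x := by
  obtain ⟨n, hn⟩ : ∃ n, u.V.card = n := ⟨_, rfl⟩
  induction n using Nat.strong_induction_on generalizing u with
  | _ n ih =>
    have IH := fun c : u.children u.root =>
      ih _ (hn ▸ u.card_subtree_lt c.2) (u.subtree c.1) rfl
    choose D' hD' hDW using IH
    let e := (Fintype.equivFin (u.children u.root)).symm
    set l := Fintype.card (u.children u.root)
    let g : u.children u.root → Tree := fun c => Tree.mk (u.subtree c.1)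
    have hg : (Finset.univ : Finset (Fin l)).val.map (fun k => g (e k)) = u.branches :=
      (map_univ_comp_equiv e g).trans u.branches_eq_univ.symm
    have hD : (Tree.mk u).D W = fun y => iteratedFDeriv ℝ l W y fun k => (g (e k)).D W y := by
      ext1 y
      exact D_eq hW hg y
    have hder := ((differentiable_iteratedFDeriv hW l) x).hasFDerivAt.continuousMultilinearMap_apply
      fun k => hD' (e k)
    rw [hD]
    refine ⟨_, hder, ?_⟩
    rw [u.sum_vertices]
    simp only [add_apply, sum_apply,
      ContinuousLinearMap.comp_apply, ContinuousMultilinearMap.apply_apply]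
    congr 1
    -- Product rule: differentiating `W^(l)` itself inserts a further argument `W x`, that is, a
    -- leaf at the root. The other goal differentiates the `k`-th argument, which by induction puts
    -- a leaf inside the `k`-th branch.
    · have hb : (Finset.univ : Finset (Fin (l + 1))).val.map
          (Fin.cons Tree.τ fun k => g (e k) : Fin (l + 1) → Tree) =
          (Tree.mk (u.attachTop u.root)).branches := by
        rw [Tree.branches_mk, LTree.attachTop, LTree.branches_attach_root rfl Tree.branches_τ, ← hg,
          Fin.univ_val_map, Fin.univ_val_map, List.ofFn_succ]
        rfl
      have hτ : Tree.τ.D W x = W x := by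
        rw [D_eq hW (l := 0) (g := Fin.elim0) (by rw [Tree.branches_τ]; rfl),
          iteratedFDeriv_zero_apply]
      rw [D_eq hW hb, iteratedFDeriv_succ_apply_left]
      simp only [Fin.cons_zero, hτ]
      rfl
    · rw [← e.sum_comp]
      refine Finset.sum_congr rfl fun k _ => ?_
      rw [hDW, map_sum]
      refine Finset.sum_congr rfl fun v _ => ?_
      have hv := LTree.mem_subtree.1 v.2
      have hb : (Finset.univ : Finset (Fin l)).val.map (Function.update (fun k => g (e k)) k
          (Tree.mk ((u.subtree (e k).1).attachTop v))) =
          (Tree.mk (u.attachTop ⟨v, hv.1⟩)).branches := by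
        rw [Tree.branches_mk, show u.attachTop ⟨v, hv.1⟩ =
          u.attach v hv.1 u.top u.lt_top from rfl, LTree.branches_attach (e k) hv.2,
          LTree.mk_attach, ← map_univ_comp_equiv e]
        congr 1
        ext1 k'
        exact (congrFun (Function.update_comp_eq_of_injective g e.injective k _) k').symm
      rw [D_eq hW hb, ContinuousMultilinearMap.toContinuousLinearMap_apply]
      congr 1
      ext1 k'
      by_cases hk : k' = k
      · subst hk
        simp
      · rw [Function.update_of_ne hk, Function.update_of_ne hk]

end Differentials

/-! ### Bounds for derivatives and elementary differentials. -/

section Norms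

variable {N : ℕ} {W : EuclideanSpace ℝ (Fin N) → EuclideanSpace ℝ (Fin N)}

theorem derivNorm_nonneg (n : ℕ) (W : EuclideanSpace ℝ (Fin N) → EuclideanSpace ℝ (Fin N)) :
    0 ≤ derivNorm n W := by
  refine Real.sSup_nonneg fun a ha => ?_
  obtain ⟨x, U, -, rfl⟩ := ha
  exact norm_nonneg _

theorem cNorm_nonneg (n : ℕ) (W : EuclideanSpace ℝ (Fin N) → EuclideanSpace ℝ (Fin N)) :
    0 ≤ cNorm n W := Finset.sum_nonneg fun i _ => derivNorm_nonneg i W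

theorem norm_iteratedFDeriv_le_derivNorm (hW : CbSmooth W) (n : ℕ)
    (x : EuclideanSpace ℝ (Fin N)) : ‖iteratedFDeriv ℝ n W x‖ ≤ derivNorm n W := by
  refine ContinuousMultilinearMap.opNorm_le_bound (derivNorm_nonneg n W) fun v => ?_
  -- If no argument vanishes, all are rescaled to unit vectors. The vanishing case also covers
  -- dimension zero with `n ≥ 1`, where there are no unit vectors and the supremum is that of the
  -- empty set.
  by_cases hv : ∃ i, v i = 0
  · obtain ⟨i, hi⟩ := hv
    rw [(iteratedFDeriv ℝ n W x).map_coord_zero i hi, norm_zero]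
    exact mul_nonneg (derivNorm_nonneg n W) (Finset.prod_nonneg fun i _ => norm_nonneg _)
  · push Not at hv
    have hv' : v = fun i => ‖v i‖ • (‖v i‖⁻¹ • v i) := by
      ext1 i
      rw [smul_smul, mul_inv_cancel₀ (norm_ne_zero_iff.2 (hv i)), one_smul]
    have hunit : ∀ i, ‖‖v i‖⁻¹ • v i‖ = 1 := fun i => by
      rw [norm_smul, norm_inv, norm_norm, inv_mul_cancel₀ (norm_ne_zero_iff.2 (hv i))]
    conv_lhs => rw [hv', ContinuousMultilinearMap.map_smul_univ, norm_smul]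
    rw [mul_comm, norm_prod]
    simp only [norm_norm]
    refine mul_le_mul_of_nonneg_right ?_ (Finset.prod_nonneg fun i _ => norm_nonneg _)
    refine le_csSup ?_ ⟨x, _, hunit, rfl⟩
    obtain ⟨M, hM⟩ := hW.2 n
    refine ⟨M, ?_⟩
    rintro a ⟨y, U, hU, rfl⟩
    refine ((iteratedFDeriv ℝ n W y).le_opNorm U).trans ?_
    simpa [hU] using hM y

theorem norm_iteratedFDeriv_le_cNorm (hW : CbSmooth W) {n q : ℕ} (hnq : n ≤ q)
    (x : EuclideanSpace ℝ (Fin N)) : ‖iteratedFDeriv ℝ n W x‖ ≤ cNorm q W :=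
  (norm_iteratedFDeriv_le_derivNorm hW n x).trans
    (Finset.single_le_sum (f := fun i => derivNorm i W) (fun i _ => derivNorm_nonneg i W)
      (Finset.mem_range.2 (Nat.lt_succ_of_le hnq)))

/-- Only the number of branches at the root is limited by `q`, not the order of `t`. This permits
its use in `norm_tupleTerm_le`, where the order may exceed `q + 1`. -/
theorem norm_D_le_of_branches (hW : CbSmooth W) {q : ℕ} (t : Tree) (ht : t.branches.card ≤ q)
    (x : EuclideanSpace ℝ (Fin N)) (h : ∀ t' ∈ t.branches, ‖t'.D W x‖ ≤ cNorm q W ^ t'.r) :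
    ‖t.D W x‖ ≤ cNorm q W ^ t.r := by
  obtain ⟨g, hg⟩ := exists_map_univ_eq t.branches
  have hmem : ∀ k, g k ∈ t.branches := fun k => by
    rw [← hg]
    exact Multiset.mem_map_of_mem g (Finset.mem_univ k)
  have hr : t.r = 1 + ∑ k, (g k).r := by
    rw [t.r_eq]
    congr 1
    conv_lhs => rw [← hg, Multiset.map_map]
    rfl
  rw [D_eq hW.1 hg, hr, pow_add, pow_one, ← Finset.prod_pow_eq_pow_sum]
  refine (ContinuousMultilinearMap.le_opNorm _ _).trans ?_
  refine mul_le_mul (norm_iteratedFDeriv_le_cNorm hW ht x) ?_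
    (Finset.prod_nonneg fun _ _ => norm_nonneg _) (cNorm_nonneg q W)
  exact Finset.prod_le_prod (fun _ _ => norm_nonneg _) fun k _ => h _ (hmem k)

theorem norm_D_le (hW : CbSmooth W) {q : ℕ} (t : Tree) (ht : t.r ≤ q + 1)
    (x : EuclideanSpace ℝ (Fin N)) : ‖t.D W x‖ ≤ cNorm q W ^ t.r := by
  obtain ⟨n, hn⟩ : ∃ n, t.r = n := ⟨_, rfl⟩
  induction n using Nat.strong_induction_on generalizing t with
  | _ n ih =>
    have hlt := t.card_branches_lt
    refine norm_D_le_of_branches hW t (by omega) x fun t' ht' => ?_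
    have := Tree.r_lt_of_mem_branches ht'
    exact ih _ (by omega) t' (by omega) rfl

end Norms

/-! ### Taylor expansion of the flow. -/

section Flow

/-- Taylor's formula for a function whose successive derivatives are given by a sequence of
functions. -/
theorem norm_sub_taylor_le {E : Type*} [NormedAddCommGroup E] [NormedSpace ℝ E] (n : ℕ)
    (f : ℕ → ℝ → E) {a M : ℝ}
    (hf : ∀ q < n, ∀ t ∈ Set.Icc 0 a, HasDerivWithinAt (f q) (f (q + 1) t) (Set.Icc 0 a) t)
    (hM : ∀ t ∈ Set.Icc 0 a, ‖f n t‖ ≤ M) :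
    ∀ t ∈ Set.Icc 0 a, ‖f 0 t - ∑ q ∈ Finset.range n, (t ^ q / (q.factorial : ℝ)) • f q 0‖ ≤
      M * (t ^ n / n.factorial) := by
  induction n generalizing f with
  | zero => simpa using hM
  | succ n ih =>
    have ih' := ih (fun q => f (q + 1)) (fun q hq => hf (q + 1) (by omega)) hM
    have hpow : ∀ (q : ℕ) (t : ℝ), HasDerivAt (fun t : ℝ => t ^ (q + 1) / ((q + 1).factorial : ℝ))
        (t ^ q / q.factorial) t := by
      intro q t
      have h := (hasDerivAt_pow (q + 1) t).div_const ((q + 1).factorial : ℝ)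
      refine h.congr_deriv ?_
      rw [Nat.factorial_succ]
      have h1 : ((q : ℝ) + 1) ≠ 0 := by positivity
      have h2 : (q.factorial : ℝ) ≠ 0 := by positivity
      push_cast
      field_simp
    have hsum : ∀ t : ℝ, ∑ q ∈ Finset.range (n + 1), (t ^ q / (q.factorial : ℝ)) • f q 0 =
        f 0 0 + ∑ q ∈ Finset.range n, (t ^ (q + 1) / ((q + 1).factorial : ℝ)) • f (q + 1) 0 := by
      intro t
      rw [Finset.sum_range_succ']
      simp [add_comm]
    have hder : ∀ t ∈ Set.Icc 0 a, HasDerivWithinAt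
        (fun t => f 0 t - ∑ q ∈ Finset.range (n + 1), (t ^ q / (q.factorial : ℝ)) • f q 0)
        (f 1 t - ∑ q ∈ Finset.range n, (t ^ q / (q.factorial : ℝ)) • f (q + 1) 0)
        (Set.Icc 0 a) t := by
      intro t ht
      simp only [hsum]
      refine (hf 0 (by omega) t ht).sub (HasDerivWithinAt.const_add _ ?_)
      exact HasDerivWithinAt.fun_sum fun q _ => ((hpow q t).smul_const _).hasDerivWithinAt
    -- The remainder vanishes at `0`, and its derivative is the remainder of the shifted sequence,
    -- bounded by the derivative of the claimed bound.
    refine image_norm_le_of_norm_deriv_right_le_deriv_boundary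
      (fun t ht => (hder t ht).continuousWithinAt)
      (fun t ht => (hder t ⟨ht.1, ht.2.le⟩).mono_of_mem_nhdsWithin
        (Filter.mem_of_superset (Icc_mem_nhdsGE ht.2) (Set.Icc_subset_Icc_left ht.1)))
      ?_ (fun t => (hpow n t).const_mul M) (fun t ht => ih' t ⟨ht.1, ht.2.le⟩)
    rw [hsum]
    simp

theorem labelled_zero : LTree.labelled 0 = ∅ := by
  refine Finset.eq_empty_of_forall_notMem fun u hu => ?_
  have := LTree.card_of_mem_labelled hu
  exact absurd u.nonempty.card_pos (by omega)

theorem flow_expansion (m : ℕ) : ∃ C : ℝ, 0 < C ∧ ∀ (N : ℕ)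
    (W : EuclideanSpace ℝ (Fin N) → EuclideanSpace ℝ (Fin N)), CbSmooth W →
    ∀ (y₀ : EuclideanSpace ℝ (Fin N)) (s : ℝ), 0 ≤ s →
      ‖flow (s • W) y₀ - (y₀ + ∑ t ∈ Tree.upTo m,
        (s ^ t.r / (t.r.factorial : ℝ) * (t.α : ℝ)) • Tree.D W t y₀)‖
        ≤ C * s ^ (m + 1) * cNorm (m + 1) W ^ (m + 1) := by
  -- Each labelled tree on `m + 1` vertices contributes at most `‖W‖^(m+1)` to the last derivative;
  -- `+ 1` makes positivity immediate, and `1/(m+1)!` is discarded.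
  refine ⟨(LTree.labelled (m + 1)).card + 1, by positivity, fun N W hW y₀ s hs => ?_⟩
  obtain ⟨y, hy⟩ := hW.exists_isSolution y₀ hs
  rw [hW.flow_smul_eq hs hy, sum_upTo_α m (fun n => s ^ n / (n.factorial : ℝ)) fun t => t.D W y₀]
  let F : ℕ → ℝ → EuclideanSpace ℝ (Fin N) := fun q τ => ∑ u ∈ LTree.labelled q, (Tree.mk u).D W (y τ)
  -- At `q = 0` the sum `F 0` is empty, so the solution itself takes its place.
  let f : ℕ → ℝ → EuclideanSpace ℝ (Fin N) := fun q => if q = 0 then y else F q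
  have hF1 : ∀ τ, F 1 τ = W (y τ) := by
    intro τ
    simp only [F, LTree.labelled_one, Finset.sum_singleton]
    rw [D_eq hW.1 (l := 0) (g := Fin.elim0), iteratedFDeriv_zero_apply]
    exact Tree.branches_τ.symm
  have hf : ∀ q < m + 1, ∀ τ ∈ Set.Icc 0 s,
      HasDerivWithinAt (f q) (f (q + 1) τ) (Set.Icc 0 s) τ := by
    intro q _ τ hτ
    rcases Nat.eq_zero_or_pos q with rfl | hq
    · simpa [f, hF1] using hy.2 τ hτ
    · simp only [f, hq.ne', if_false, Nat.succ_ne_zero, F]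
      rw [LTree.sum_labelled_succ q hq]
      refine HasDerivWithinAt.fun_sum fun u _ => ?_
      obtain ⟨D', hD', hDW⟩ := hasFDerivAt_D hW.1 u (y τ)
      rw [← hDW]
      exact hD'.comp_hasDerivWithinAt τ (hy.2 τ hτ)
  have hM : ∀ τ ∈ Set.Icc 0 s, ‖f (m + 1) τ‖ ≤
      (LTree.labelled (m + 1)).card * cNorm (m + 1) W ^ (m + 1) := by
    intro τ _
    simp only [f, Nat.succ_ne_zero, if_false, F]
    rw [← nsmul_eq_mul]
    refine norm_sum_le_of_le _ (fun u hu => ?_) |>.trans (Finset.sum_const _).le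
    have hr : (Tree.mk u).r = m + 1 := LTree.card_of_mem_labelled hu
    have := norm_D_le hW (q := m + 1) (Tree.mk u) (by omega) (y τ)
    rwa [hr] at this
  have key := norm_sub_taylor_le (m + 1) f hf hM s ⟨hs, le_rfl⟩
  have hsum : ∑ q ∈ Finset.range (m + 1), (s ^ q / (q.factorial : ℝ)) • f q 0 =
      y₀ + ∑ n ∈ Finset.range (m + 1),
        (s ^ n / (n.factorial : ℝ)) • ∑ u ∈ LTree.labelled n, (Tree.mk u).D W y₀ := by
    rw [Finset.sum_range_succ', Finset.sum_range_succ', labelled_zero]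
    simp [f, F, hy.1, add_comm]
  rw [hsum] at key
  refine key.trans ?_
  have h1 : s ^ (m + 1) / ((m + 1).factorial : ℝ) ≤ s ^ (m + 1) :=
    div_le_self (by positivity) (by exact_mod_cast Nat.one_le_iff_ne_zero.2 (Nat.factorial_ne_zero _))
  have h2 : 0 ≤ cNorm (m + 1) W ^ (m + 1) := pow_nonneg (cNorm_nonneg _ _) _
  calc _ ≤ ((LTree.labelled (m + 1)).card + 1) * cNorm (m + 1) W ^ (m + 1) * s ^ (m + 1) := by
        refine mul_le_mul ?_ h1 (by positivity) (by positivity)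
        exact mul_le_mul_of_nonneg_right (by linarith) h2
    _ = _ := by ring

end Flow

/-! ### Symmetry coefficients, grafting and the count of tuples. -/

namespace Tree

/-- Isolates the factorials of the multiplicities, the part of `σ` that comes from counting
enumerations of the branches. -/
theorem σ_eq_mul (t : Tree) : t.σ =
    (∏ t' ∈ t.branches.toFinset, (t.branches.count t').factorial) * (t.branches.map σ).prod := by
  rw [σ_eq, Finset.prod_mul_distrib, Finset.prod_multiset_map_count]

theorem σ_pos (t : Tree) : 0 < t.σ := by
  obtain ⟨n, hn⟩ : ∃ n, t.r = n := ⟨_, rfl⟩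
  induction n using Nat.strong_induction_on generalizing t with
  | _ n ih =>
    rw [σ_eq]
    refine Finset.prod_pos fun t' ht' => Nat.mul_pos (Nat.factorial_pos _) (Nat.pow_pos ?_)
    exact ih _ (hn ▸ r_lt_of_mem_branches (Multiset.mem_toFinset.1 ht')) t' rfl

theorem prod_σ_pos (t : Tree) : 0 < (t.branches.map σ).prod :=
  Multiset.prod_pos fun n hn => by
    obtain ⟨t', -, rfl⟩ := Multiset.mem_map.1 hn
    exact t'.σ_pos

/-- The tree with given branches. -/
def graft {l : ℕ} (τ : Fin l → Tree) : Tree :=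
  branchesEquiv.symm ((Finset.univ : Finset (Fin l)).val.map τ)

theorem branches_graft {l : ℕ} (τ : Fin l → Tree) :
    (graft τ).branches = (Finset.univ : Finset (Fin l)).val.map τ :=
  branchesEquiv.apply_symm_apply _

theorem graft_eq_iff {l : ℕ} {τ : Fin l → Tree} {t : Tree} :
    graft τ = t ↔ (Finset.univ : Finset (Fin l)).val.map τ = t.branches := by
  rw [← branches_graft]
  exact branches_injective.eq_iff.symm

theorem card_branches_graft {l : ℕ} (τ : Fin l → Tree) : (graft τ).branches.card = l := by
  rw [branches_graft]
  simp

theorem r_graft {l : ℕ} (τ : Fin l → Tree) : (graft τ).r = 1 + ∑ k, (τ k).r := by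
  rw [r_eq, branches_graft, Multiset.map_map]
  rfl

theorem prod_map_branches_graft {M : Type*} [CommMonoid M] {l : ℕ} (τ : Fin l → Tree)
    (f : Tree → M) : ((graft τ).branches.map f).prod = ∏ k, f (τ k) := by
  rw [branches_graft, Multiset.map_map]
  rfl

theorem mem_upTo {m : ℕ} {t : Tree} : t ∈ upTo m ↔ t.r ≤ m := by
  simp [upTo]

end Tree

/-- The number of tuples enumerating a given multiset. -/
theorem card_tuples_mul {α : Type*} [DecidableEq α] (p : Multiset α) (Q : Finset (Σ l, Fin l → α))
    (hQ : ∀ q, q ∈ Q ↔ (Finset.univ : Finset (Fin q.1)).val.map q.2 = p) :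
    Q.card * ∏ a ∈ p.toFinset, (p.count a).factorial = p.card.factorial := by
  classical
  obtain ⟨τ₀, h₀⟩ := exists_map_univ_eq p
  have hmap : ∀ π ∈ (Finset.univ : Finset (Equiv.Perm (Fin p.card))),
      (⟨p.card, τ₀ ∘ π⟩ : Σ l, Fin l → α) ∈ Q := by
    intro π _
    rw [hQ]
    exact (map_univ_comp_equiv π τ₀).trans h₀
  -- Orbit counting: permutations act transitively on the enumerations of `p`, and the stabiliser of
  -- one of them permutes equal entries only.
  have hstab : Fintype.card {π : Equiv.Perm (Fin p.card) // τ₀ ∘ π = τ₀} =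
      ∏ a ∈ p.toFinset, (p.count a).factorial := by
    rw [DomMulAct.stabilizer_card']
    have himg : Finset.univ.image τ₀ = p.toFinset := by
      have h := congrArg Multiset.toFinset h₀
      rwa [Multiset.toFinset_map, Finset.val_toFinset] at h
    rw [himg]
    refine Finset.prod_congr rfl fun a _ => ?_
    congr 1
    conv_rhs => rw [← h₀, Multiset.count_map]
    rw [Fintype.card_subtype, Finset.card, Finset.filter_val]
    congr 2
    ext k
    exact eq_comm
  have hfib : ∀ q ∈ Q, (Finset.univ.filter fun π : Equiv.Perm (Fin p.card) =>
      (⟨p.card, τ₀ ∘ π⟩ : Σ l, Fin l → α) = q).card = ∏ a ∈ p.toFinset, (p.count a).factorial := by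
    rintro ⟨l, τ⟩ hq
    have hτ := (hQ _).1 hq
    simp only at hτ
    obtain rfl : l = p.card := by
      rw [← hτ]
      simp
    obtain ⟨e, he⟩ := exists_equiv_of_map_univ_eq (hτ.trans h₀.symm)
    rw [← hstab, ← Fintype.card_subtype]
    have hτe : τ = τ₀ ∘ e := funext he
    subst hτe
    -- The permutations leading to a given enumeration form a coset of the stabiliser.
    refine Fintype.card_congr (Equiv.subtypeEquiv (Equiv.mulRight e⁻¹) fun π => ?_)
    simp only [Sigma.mk.injEq, heq_eq_eq, true_and, Equiv.coe_mulRight, Equiv.Perm.coe_mul]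
    constructor
    · intro h
      rw [← Function.comp_assoc, h]
      ext k
      simp
    · intro h
      rw [← Function.comp_assoc] at h
      conv_rhs => rw [← h]
      ext k
      simp
  have := Finset.card_eq_sum_card_fiberwise hmap
  rw [Finset.sum_congr rfl hfib, Finset.sum_const, smul_eq_mul, Finset.card_univ,
    Fintype.card_perm, Fintype.card_fin] at this
  exact this.symm

/-! ### Multilinear expansion over tuples of trees. -/

section Expansion

variable {K : ℕ} (A : Matrix (Fin K) (Fin K) ℝ)

/-- The product `∏ k, ζ_j(t_k; A)` for `t = [t_1 ⋯ t_l]`. -/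
def stageWeight (t : Tree) (j : Fin K) : ℝ := (t.branches.map fun t' => t'.ζ A j).prod

theorem ζ_eq_sum_stageWeight (t : Tree) (i : Fin K) :
    t.ζ A i = ∑ j, A i j * stageWeight A t j := Tree.ζ_eq A t i

variable {N : ℕ} {W : EuclideanSpace ℝ (Fin N) → EuclideanSpace ℝ (Fin N)}

/-- The contribution of one enumeration of the branches of `t` to the expansion of a stage. -/
def tupleTerm (W : EuclideanSpace ℝ (Fin N) → EuclideanSpace ℝ (Fin N))
    (x : EuclideanSpace ℝ (Fin N)) (s : ℝ) (j : Fin K) (t : Tree) : EuclideanSpace ℝ (Fin N) :=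
  (s ^ t.r / (t.branches.card.factorial * ((t.branches.map Tree.σ).prod : ℕ)) *
    stageWeight A t j) • t.D W x

/-- By multilinearity the argument sums become a sum over tuples. The outer factor `s` supplies the
power belonging to the new root, and the product of the `ζ` is the stage weight of the grafted tree.
-/
theorem smul_iteratedFDeriv_sum (hW : ContDiff ℝ ((⊤ : ℕ∞) : WithTop ℕ∞) W)
    (x : EuclideanSpace ℝ (Fin N)) (s : ℝ) (j : Fin K) (S : Finset Tree) (l : ℕ) :
    (s / (l.factorial : ℝ)) • iteratedFDeriv ℝ l W x
      (fun _ => ∑ t ∈ S, (s ^ t.r / (t.σ : ℝ) * t.ζ A j) • t.D W x) =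
    ∑ τ ∈ Fintype.piFinset fun _ : Fin l => S, tupleTerm A W x s j (Tree.graft τ) := by
  rw [ContinuousMultilinearMap.map_sum_finset, Finset.smul_sum]
  refine Finset.sum_congr rfl fun τ _ => ?_
  rw [ContinuousMultilinearMap.map_smul_univ, ← D_eq hW (Tree.branches_graft τ).symm, smul_smul,
    tupleTerm]
  congr 1
  rw [stageWeight, Tree.prod_map_branches_graft, Tree.prod_map_branches_graft,
    Tree.card_branches_graft, Tree.r_graft, Finset.prod_mul_distrib, Finset.prod_div_distrib,
    Finset.prod_pow_eq_pow_sum, pow_add, pow_one, Nat.cast_prod]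
  have h1 : (∏ k, ((τ k).σ : ℝ)) ≠ 0 :=
    Finset.prod_ne_zero_iff.2 fun k _ => Nat.cast_ne_zero.2 (τ k).σ_pos.ne'
  have h2 : (l.factorial : ℝ) ≠ 0 := by positivity
  field_simp

/-- Tuples of trees of order at most `m`, of length at most `m`. -/
def tuples (m : ℕ) : Finset (Σ l, Fin l → Tree) :=
  (Finset.range (m + 1)).sigma fun l => Fintype.piFinset fun _ : Fin l => Tree.upTo m

/-- The tuples whose tree is of order at most `m + 1` contribute the trees in `T_{≤ m + 1}`, each
with the weight given by its symmetry. -/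
theorem sum_tupleTerm (x : EuclideanSpace ℝ (Fin N)) (s : ℝ) (j : Fin K) (m : ℕ) :
    ∑ p ∈ (tuples m).filter (fun p => (Tree.graft p.2).r ≤ m + 1),
      tupleTerm A W x s j (Tree.graft p.2) =
    ∑ t ∈ Tree.upTo (m + 1), (s ^ t.r / (t.σ : ℝ) * stageWeight A t j) • t.D W x := by
  have hmaps : ∀ p ∈ (tuples m).filter (fun p => (Tree.graft p.2).r ≤ m + 1),
      Tree.graft p.2 ∈ Tree.upTo (m + 1) :=
    fun p hp => Tree.mem_upTo.2 (Finset.mem_filter.1 hp).2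
  rw [← Finset.sum_fiberwise_of_maps_to hmaps]
  refine Finset.sum_congr rfl fun t ht => ?_
  rw [Tree.mem_upTo] at ht
  rw [Finset.sum_congr rfl fun p hp => by rw [(Finset.mem_filter.1 hp).2], Finset.sum_const]
  -- All terms in the fibre over `t` are equal, so only their number matters. No enumeration is
  -- missing: order at most `m + 1` forces at most `m` branches, each of order at most `m`.
  have hcount := card_tuples_mul t.branches
    (((tuples m).filter (fun p => (Tree.graft p.2).r ≤ m + 1)).filter
      fun p => Tree.graft p.2 = t) (by
    rintro ⟨l, τ⟩
    rw [Finset.mem_filter, Finset.mem_filter, Tree.graft_eq_iff]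
    refine ⟨fun h => h.2, fun h => ⟨⟨?_, ?_⟩, h⟩⟩
    · rw [tuples, Finset.mem_sigma, Finset.mem_range, Fintype.mem_piFinset]
      have hl := t.card_branches_lt
      rw [← h] at hl
      simp only [Multiset.card_map, Finset.card_val, Finset.card_univ, Fintype.card_fin] at hl
      refine ⟨by simp only; omega, fun k => Tree.mem_upTo.2 ?_⟩
      have hk : τ k ∈ t.branches := by
        rw [← h]
        exact Multiset.mem_map_of_mem τ (Finset.mem_univ k)
      have := Tree.r_lt_of_mem_branches hk
      show (τ k).r ≤ m
      omega
    · rw [Tree.graft_eq_iff.2 h]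
      exact ht)
  rw [tupleTerm, ← Nat.cast_smul_eq_nsmul ℝ, smul_smul]
  congr 1
  rw [t.σ_eq_mul, ← hcount]
  set c := (((tuples m).filter (fun p => (Tree.graft p.2).r ≤ m + 1)).filter
      fun p => Tree.graft p.2 = t).card
  have hc : (c : ℝ) ≠ 0 := by
    intro h0
    rw [Nat.cast_eq_zero.1 h0, zero_mul] at hcount
    exact (Nat.factorial_pos _).ne hcount
  have h1 : (∏ a ∈ t.branches.toFinset, ((t.branches.count a).factorial : ℝ)) ≠ 0 :=
    Finset.prod_ne_zero_iff.2 fun _ _ => by positivity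
  have h2 : ((t.branches.map Tree.σ).prod : ℝ) ≠ 0 := Nat.cast_ne_zero.2 t.prod_σ_pos.ne'
  push_cast
  push_cast at h2
  field_simp

/-- These are the surplus trees from the multilinear expansion; since `s‖W‖ ≤ 1`, every power from
`m + 2` on is dominated by the power `m + 2`. -/
theorem norm_tupleTerm_le (hW : CbSmooth W) {q m : ℕ} (hmq : m ≤ q) (x : EuclideanSpace ℝ (Fin N))
    {s : ℝ} (hs : 0 ≤ s) (hs1 : s * cNorm q W ≤ 1) (j : Fin K) {p : Σ l, Fin l → Tree}
    (hp : p ∈ tuples m) (hr : m + 2 ≤ (Tree.graft p.2).r) :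
    ‖tupleTerm A W x s j (Tree.graft p.2)‖ ≤
      |stageWeight A (Tree.graft p.2) j| * (s * cNorm q W) ^ (m + 2) := by
  obtain ⟨l, τ⟩ := p
  rw [tuples, Finset.mem_sigma, Finset.mem_range, Fintype.mem_piFinset] at hp
  simp only at hp hr ⊢
  set t := Tree.graft τ with ht
  have hM := cNorm_nonneg q W
  have hD : ‖t.D W x‖ ≤ cNorm q W ^ t.r := by
    refine norm_D_le_of_branches hW t ?_ x fun t' ht' => norm_D_le hW t' ?_ x
    · rw [ht, Tree.card_branches_graft]
      omega
    · rw [ht, Tree.branches_graft] at ht'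
      obtain ⟨k, -, rfl⟩ := Multiset.mem_map.1 ht'
      have := Tree.mem_upTo.1 (hp.2 k)
      omega
  have hden : (1 : ℝ) ≤ t.branches.card.factorial * ((t.branches.map Tree.σ).prod : ℕ) := by
    exact_mod_cast Nat.mul_pos (Nat.factorial_pos _) t.prod_σ_pos
  rw [tupleTerm, norm_smul, norm_mul, Real.norm_eq_abs, Real.norm_eq_abs, abs_div,
    abs_of_nonneg (pow_nonneg hs _), abs_of_nonneg (zero_le_one.trans hden)]
  have h1 : s ^ t.r / (t.branches.card.factorial * ((t.branches.map Tree.σ).prod : ℕ)) ≤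
      s ^ t.r := div_le_self (pow_nonneg hs _) hden
  calc _ ≤ s ^ t.r * |stageWeight A t j| * cNorm q W ^ t.r := by gcongr
    _ = |stageWeight A t j| * (s * cNorm q W) ^ t.r := by rw [mul_pow]; ring
    _ ≤ _ := by
      refine mul_le_mul_of_nonneg_left ?_ (abs_nonneg _)
      exact pow_le_pow_of_le_one (mul_nonneg hs hM) hs1 hr

end Expansion

/-! ### Expansion of the Runge–Kutta stages and output. -/

section Stages

variable {N : ℕ} {W : EuclideanSpace ℝ (Fin N) → EuclideanSpace ℝ (Fin N)}

/-- `norm_sub_taylor_le` applied to `t ↦ W (x + t • z)` on `[0, 1]`. -/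
theorem norm_sub_taylor_field_le (hW : CbSmooth W) {n q : ℕ} (hnq : n ≤ q)
    (x z : EuclideanSpace ℝ (Fin N)) :
    ‖W (x + z) - ∑ l ∈ Finset.range n, (1 / (l.factorial : ℝ)) • iteratedFDeriv ℝ l W x fun _ => z‖
      ≤ cNorm q W * ‖z‖ ^ n := by
  let f : ℕ → ℝ → EuclideanSpace ℝ (Fin N) := fun l t =>
    iteratedFDeriv ℝ l W (x + t • z) fun _ => z
  have hf : ∀ l < n, ∀ t ∈ Set.Icc (0 : ℝ) 1,
      HasDerivWithinAt (f l) (f (l + 1) t) (Set.Icc 0 1) t := by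
    intro l _ t _
    have h1 : HasDerivAt (fun t : ℝ => x + t • z) z t := by
      simpa using ((hasDerivAt_id t).smul_const z).const_add x
    have h2 := ((differentiable_iteratedFDeriv hW.1 l)
      (x + t • z)).hasFDerivAt.continuousMultilinear_apply_const fun _ => z
    exact (h2.comp_hasDerivAt t h1).hasDerivWithinAt
  have hM : ∀ t ∈ Set.Icc (0 : ℝ) 1, ‖f n t‖ ≤ cNorm q W * ‖z‖ ^ n := by
    intro t _
    refine ((iteratedFDeriv ℝ n W (x + t • z)).le_opNorm _).trans ?_
    rw [Finset.prod_const, Finset.card_univ, Fintype.card_fin]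
    exact mul_le_mul_of_nonneg_right (norm_iteratedFDeriv_le_cNorm hW hnq _) (by positivity)
  have key := norm_sub_taylor_le n f hf hM 1 ⟨zero_le_one, le_rfl⟩
  simp only [f, iteratedFDeriv_zero_apply, one_smul, zero_smul, add_zero, one_pow] at key
  refine key.trans (mul_le_of_le_one_right (mul_nonneg (cNorm_nonneg _ _) (by positivity)) ?_)
  exact div_le_one_of_le₀ (by exact_mod_cast Nat.factorial_pos n) (by positivity)

theorem norm_sum_smul_le {E ι : Type*} [NormedAddCommGroup E] [NormedSpace ℝ E] [Fintype ι]
    (c : ι → ℝ) (v : ι → E) {B : ℝ} (h : ∀ k, ‖v k‖ ≤ B) :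
    ‖∑ k, c k • v k‖ ≤ (∑ k, |c k|) * B := by
  rw [Finset.sum_mul]
  refine norm_sum_le_of_le _ fun k _ => ?_
  rw [norm_smul, Real.norm_eq_abs]
  exact mul_le_mul_of_nonneg_left (h k) (abs_nonneg _)

theorem norm_smul_field_le (hW : CbSmooth W) (q : ℕ) {s : ℝ} (hs : 0 ≤ s)
    (x : EuclideanSpace ℝ (Fin N)) : ‖s • W x‖ ≤ s * cNorm q W := by
  rw [norm_smul, Real.norm_of_nonneg hs, ← norm_iteratedFDeriv_zero (𝕜 := ℝ)]
  exact mul_le_mul_of_nonneg_left (norm_iteratedFDeriv_le_cNorm hW (Nat.zero_le q) x) hs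

/-- A multilinear map changes by at most the sum of the changes in its single arguments. For `l = 0`
the factor `l` kills the bound, so the truncated exponent `l - 1` is harmless. -/
theorem smul_diff_iteratedFDeriv_le (hW : CbSmooth W) {l q : ℕ} (hlq : l ≤ q) {s : ℝ} (hs : 0 ≤ s)
    (x z w : EuclideanSpace ℝ (Fin N)) {B δ : ℝ} (hz : ‖z‖ ≤ B) (hw : ‖w‖ ≤ B)
    (hδ : ‖z - w‖ ≤ δ) :
    ‖(s / (l.factorial : ℝ)) • iteratedFDeriv ℝ l W x (fun _ => z) -
      (s / (l.factorial : ℝ)) • iteratedFDeriv ℝ l W x (fun _ => w)‖ ≤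
      s * cNorm q W * (l * B ^ (l - 1) * δ) := by
  have hB : 0 ≤ B := (norm_nonneg _).trans hz
  have hδ0 : 0 ≤ δ := (norm_nonneg _).trans hδ
  have hpi : ∀ (v : EuclideanSpace ℝ (Fin N)) {b : ℝ}, ‖v‖ ≤ b → ‖fun _ : Fin l => v‖ ≤ b :=
    fun v b h => (pi_norm_le_iff_of_nonneg ((norm_nonneg _).trans h)).2 fun _ => h
  rw [← smul_sub, norm_smul, Real.norm_of_nonneg (by positivity), mul_assoc]
  refine mul_le_mul (div_le_self hs (by exact_mod_cast Nat.factorial_pos l)) ?_ (norm_nonneg _) hs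
  refine (ContinuousMultilinearMap.norm_image_sub_le _ _ _).trans ?_
  rw [Fintype.card_fin, mul_assoc, mul_assoc, mul_assoc]
  refine mul_le_mul (norm_iteratedFDeriv_le_cNorm hW hlq x) ?_ (by positivity) (cNorm_nonneg _ _)
  refine mul_le_mul_of_nonneg_left ?_ (Nat.cast_nonneg l)
  refine mul_le_mul (pow_le_pow_left₀ (le_max_of_le_left (norm_nonneg _))
    (max_le (hpi z hz) (hpi w hw)) _) (hpi (z - w) hδ) (norm_nonneg _) (by positivity)

variable {K : ℕ} (A : Matrix (Fin K) (Fin K) ℝ)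

/-- The expansion of `W` at the stages, for small `s ‖W‖`. -/
theorem stage_expansion (q m : ℕ) (hmq : m ≤ q) : ∃ C : ℝ, 0 ≤ C ∧ ∀ (N : ℕ)
    (W : EuclideanSpace ℝ (Fin N) → EuclideanSpace ℝ (Fin N)), CbSmooth W →
    ∀ (y₀ : EuclideanSpace ℝ (Fin N)) (s : ℝ), 0 ≤ s → s * cNorm q W ≤ 1 →
    ∀ Y : Fin K → EuclideanSpace ℝ (Fin N), IsStages A W y₀ s Y → ∀ j,
      ‖s • W (Y j) - ∑ t ∈ Tree.upTo m, (s ^ t.r / (t.σ : ℝ) * stageWeight A t j) • t.D W y₀‖ ≤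
        C * (s * cNorm q W) ^ (m + 1) := by
  induction m with
  | zero =>
    refine ⟨1, zero_le_one, fun N W hW y₀ s hs _ Y _ j => ?_⟩
    have h0 : Tree.upTo 0 = ∅ := Finset.eq_empty_of_forall_notMem fun t ht => by
      have := Tree.mem_upTo.1 ht
      have := t.r_pos
      omega
    rw [h0, Finset.sum_empty, sub_zero, zero_add, pow_one, one_mul]
    exact norm_smul_field_le hW q hs _
  | succ m ih =>
    obtain ⟨C, hC, ih⟩ := ih (by omega)
    set a : ℝ := ∑ i, ∑ k, |A i k| with ha
    have hrow : ∀ j, ∑ k, |A j k| ≤ a := fun j =>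
      Finset.single_le_sum (f := fun i => ∑ k, |A i k|)
        (fun i _ => Finset.sum_nonneg fun k _ => abs_nonneg _) (Finset.mem_univ j)
    have ha0 : 0 ≤ a := Finset.sum_nonneg fun i _ => Finset.sum_nonneg fun k _ => abs_nonneg _
    -- The three summands belong to `e1`, `e2`, `e3`: the Taylor remainder, the replacement of `z`
    -- by its expansion `w`, and the trees of order above `m + 1`. In each, the factor `s` in front
    -- of `W` supplies the extra power of `h`.
    refine ⟨a ^ (m + 1) + ∑ l ∈ Finset.range (m + 1), l * (a * (1 + C)) ^ (l - 1) * (a * C) +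
      ∑ p ∈ tuples m, ∑ j, |stageWeight A (Tree.graft p.2) j|, by positivity, ?_⟩
    intro N W hW y₀ s hs hs1 Y hY j
    set h := s * cNorm q W with hh
    have hh0 : 0 ≤ h := mul_nonneg hs (cNorm_nonneg _ _)
    have hpow : h ^ (m + 1) ≤ 1 := pow_le_one₀ hh0 hs1
    set z := Y j - y₀ with hz
    set w := ∑ t ∈ Tree.upTo m, (s ^ t.r / (t.σ : ℝ) * t.ζ A j) • t.D W y₀ with hw
    have hz' : z = ∑ k, A j k • (s • W (Y k)) := by
      rw [hz, hY j, add_sub_cancel_left, Finset.smul_sum]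
      exact Finset.sum_congr rfl fun k _ => smul_comm _ _ _
    have hw' : w = ∑ k, A j k • ∑ t ∈ Tree.upTo m,
        (s ^ t.r / (t.σ : ℝ) * stageWeight A t k) • t.D W y₀ := by
      simp only [Finset.smul_sum]
      rw [Finset.sum_comm, hw]
      refine Finset.sum_congr rfl fun t _ => ?_
      rw [ζ_eq_sum_stageWeight, Finset.mul_sum, Finset.sum_smul]
      refine Finset.sum_congr rfl fun k _ => ?_
      rw [smul_smul]
      congr 1
      ring
    have hzn : ‖z‖ ≤ a * h := by
      rw [hz']
      refine (norm_sum_smul_le _ _ fun k => norm_smul_field_le hW q hs (Y k)).trans ?_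
      exact mul_le_mul_of_nonneg_right (hrow j) hh0
    have hzw : ‖z - w‖ ≤ a * (C * h ^ (m + 1)) := by
      rw [hz', hw', ← Finset.sum_sub_distrib]
      simp only [← smul_sub]
      refine (norm_sum_smul_le _ _ fun k => ih N W hW y₀ s hs hs1 Y hY k).trans ?_
      exact mul_le_mul_of_nonneg_right (hrow j) (by positivity)
    have hzB : ‖z‖ ≤ a * (1 + C) := hzn.trans (mul_le_mul_of_nonneg_left (by linarith) ha0)
    -- `w` is bounded through its distance to `z`; `h ≤ 1` makes the bound independent of `h`.
    have hwB : ‖w‖ ≤ a * (1 + C) := by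
      have h1 : ‖w‖ ≤ ‖z‖ + ‖z - w‖ := by
        have := norm_sub_le z (z - w)
        rwa [sub_sub_cancel] at this
      have h2 : a * h ≤ a * 1 := mul_le_mul_of_nonneg_left hs1 ha0
      have h3 : a * (C * h ^ (m + 1)) ≤ a * (C * 1) := by gcongr
      linarith
    have e1 : ‖s • (W (y₀ + z) - ∑ l ∈ Finset.range (m + 1),
        (1 / (l.factorial : ℝ)) • iteratedFDeriv ℝ l W y₀ fun _ => z)‖ ≤
        a ^ (m + 1) * h ^ (m + 2) := by
      rw [norm_smul, Real.norm_of_nonneg hs]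
      calc _ ≤ s * (cNorm q W * ‖z‖ ^ (m + 1)) :=
            mul_le_mul_of_nonneg_left (norm_sub_taylor_field_le hW hmq y₀ z) hs
        _ = h * ‖z‖ ^ (m + 1) := by rw [hh]; ring
        _ ≤ h * (a * h) ^ (m + 1) := by gcongr
        _ = _ := by ring
    have e2 : ‖∑ l ∈ Finset.range (m + 1),
        ((s / (l.factorial : ℝ)) • iteratedFDeriv ℝ l W y₀ (fun _ => z) -
          (s / (l.factorial : ℝ)) • iteratedFDeriv ℝ l W y₀ (fun _ => w))‖ ≤
        (∑ l ∈ Finset.range (m + 1), l * (a * (1 + C)) ^ (l - 1) * (a * C)) * h ^ (m + 2) := by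
      rw [Finset.sum_mul]
      refine norm_sum_le_of_le _ fun l hl => ?_
      have hl' := Finset.mem_range.1 hl
      refine (smul_diff_iteratedFDeriv_le hW (show l ≤ q by omega) hs y₀ z w hzB hwB hzw).trans (le_of_eq ?_)
      rw [← hh]
      ring
    have e3 : ‖∑ p ∈ (tuples m).filter (fun p => ¬ (Tree.graft p.2).r ≤ m + 1),
        tupleTerm A W y₀ s j (Tree.graft p.2)‖ ≤
        (∑ p ∈ tuples m, ∑ j, |stageWeight A (Tree.graft p.2) j|) * h ^ (m + 2) := by
      rw [Finset.sum_mul]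
      refine (norm_sum_le _ _).trans ((Finset.sum_le_sum fun p hp => ?_).trans
        (Finset.sum_le_sum_of_subset_of_nonneg (Finset.filter_subset _ _) fun p _ _ => ?_))
      · obtain ⟨hp, hr⟩ := Finset.mem_filter.1 hp
        refine (norm_tupleTerm_le A hW (by omega) y₀ hs hs1 j hp (by omega)).trans ?_
        refine mul_le_mul_of_nonneg_right ?_ (by positivity)
        exact Finset.single_le_sum (f := fun j => |stageWeight A (Tree.graft p.2) j|)
          (fun i _ => abs_nonneg _) (Finset.mem_univ j)
      · positivity
    have hsplit : ∑ l ∈ Finset.range (m + 1),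
        (s / (l.factorial : ℝ)) • iteratedFDeriv ℝ l W y₀ (fun _ => w) =
        ∑ t ∈ Tree.upTo (m + 1), (s ^ t.r / (t.σ : ℝ) * stageWeight A t j) • t.D W y₀ +
        ∑ p ∈ (tuples m).filter (fun p => ¬ (Tree.graft p.2).r ≤ m + 1),
          tupleTerm A W y₀ s j (Tree.graft p.2) := by
      rw [← sum_tupleTerm A y₀ s j m, Finset.sum_filter_add_sum_filter_not, tuples,
        Finset.sum_sigma]
      exact Finset.sum_congr rfl fun l _ => smul_iteratedFDeriv_sum A hW.1 y₀ s j (Tree.upTo m) l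
    have hdec : s • W (Y j) -
        ∑ t ∈ Tree.upTo (m + 1), (s ^ t.r / (t.σ : ℝ) * stageWeight A t j) • t.D W y₀ =
        s • (W (y₀ + z) - ∑ l ∈ Finset.range (m + 1),
          (1 / (l.factorial : ℝ)) • iteratedFDeriv ℝ l W y₀ fun _ => z) +
        ∑ l ∈ Finset.range (m + 1),
          ((s / (l.factorial : ℝ)) • iteratedFDeriv ℝ l W y₀ (fun _ => z) -
            (s / (l.factorial : ℝ)) • iteratedFDeriv ℝ l W y₀ (fun _ => w)) +
        ∑ p ∈ (tuples m).filter (fun p => ¬ (Tree.graft p.2).r ≤ m + 1),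
          tupleTerm A W y₀ s j (Tree.graft p.2) := by
      rw [Finset.sum_sub_distrib, hsplit, hz, add_sub_cancel, smul_sub, Finset.smul_sum]
      simp only [smul_smul, mul_one_div]
      abel
    rw [hdec]
    refine (norm_add₃_le).trans ?_
    calc _ ≤ _ := add_le_add (add_le_add e1 e2) e3
      _ = _ := by ring

/-- The expansion of the output of a Runge–Kutta method in elementary differentials. -/
theorem rkOutput_expansion (m : ℕ) (b : Fin K → ℝ) : ∃ C : ℝ, 0 < C ∧ ∀ (N : ℕ)
    (W : EuclideanSpace ℝ (Fin N) → EuclideanSpace ℝ (Fin N)), CbSmooth W →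
    ∀ (y₀ : EuclideanSpace ℝ (Fin N)) (s : ℝ), 0 ≤ s →
    ∀ Y : Fin K → EuclideanSpace ℝ (Fin N), IsStages A W y₀ s Y →
      ‖rkOutput b W y₀ s Y - (y₀ + ∑ t ∈ Tree.upTo m,
        (s ^ t.r / (t.σ : ℝ) * ∑ i, b i * stageWeight A t i) • t.D W y₀)‖ ≤
        C * s ^ (m + 1) * cNorm (m + 1) W ^ (m + 1) := by
  obtain ⟨C, hC, hst⟩ := stage_expansion A (m + 1) m (Nat.le_succ m)
  set β : ℝ := ∑ i, |b i| with hβ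
  have hβ0 : 0 ≤ β := Finset.sum_nonneg fun i _ => abs_nonneg _
  -- `β * C` serves the case `s * M ≤ 1`; `β` and the sum over trees serve the case `s * M ≥ 1`; the
  -- final `1` gives positivity.
  refine ⟨β * C + β + ∑ t ∈ Tree.upTo m, |∑ i, b i * stageWeight A t i| + 1, by positivity, ?_⟩
  intro N W hW y₀ s hs Y hY
  set M := cNorm (m + 1) W with hM
  have hM0 : 0 ≤ M := cNorm_nonneg _ _
  have hout : rkOutput b W y₀ s Y = y₀ + ∑ i, b i • (s • W (Y i)) := by
    rw [rkOutput, Finset.smul_sum]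
    congr 1
    exact Finset.sum_congr rfl fun k _ => smul_comm _ _ _
  rw [hout, add_sub_add_left_eq_sub, mul_assoc, ← mul_pow]
  have hS : 0 ≤ ∑ t ∈ Tree.upTo m, |∑ i, b i * stageWeight A t i| :=
    Finset.sum_nonneg fun t _ => abs_nonneg _
  have hpow : 0 ≤ (s * M) ^ (m + 1) := by positivity
  rcases le_total (s * M) 1 with h1 | h1
  · have hT : ∑ t ∈ Tree.upTo m, (s ^ t.r / (t.σ : ℝ) * ∑ i, b i * stageWeight A t i) • t.D W y₀ =
        ∑ i, b i • ∑ t ∈ Tree.upTo m,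
          (s ^ t.r / (t.σ : ℝ) * stageWeight A t i) • t.D W y₀ := by
      simp only [Finset.smul_sum]
      rw [Finset.sum_comm]
      refine Finset.sum_congr rfl fun t _ => ?_
      rw [Finset.mul_sum, Finset.sum_smul]
      refine Finset.sum_congr rfl fun k _ => ?_
      rw [smul_smul]
      congr 1
      ring
    rw [hT, ← Finset.sum_sub_distrib]
    simp only [← smul_sub]
    refine (norm_sum_smul_le _ _ fun i => hst N W hW y₀ s hs h1 Y hY i).trans ?_
    rw [← mul_assoc]
    refine mul_le_mul_of_nonneg_right ?_ hpow
    linarith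
  -- For `s * M ≥ 1` no cancellation is needed: every power of `s * M` that occurs has exponent at
  -- most `m + 1`, hence is at most `(s * M) ^ (m + 1)`.
  · have e1 : ‖∑ i, b i • (s • W (Y i))‖ ≤ β * (s * M) ^ (m + 1) := by
      refine (norm_sum_smul_le _ _ fun i => norm_smul_field_le hW (m + 1) hs (Y i)).trans ?_
      exact mul_le_mul_of_nonneg_left (le_self_pow₀ h1 (Nat.succ_ne_zero m)) hβ0
    have e2 : ‖∑ t ∈ Tree.upTo m,
        (s ^ t.r / (t.σ : ℝ) * ∑ i, b i * stageWeight A t i) • t.D W y₀‖ ≤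
        (∑ t ∈ Tree.upTo m, |∑ i, b i * stageWeight A t i|) * (s * M) ^ (m + 1) := by
      rw [Finset.sum_mul]
      refine norm_sum_le_of_le _ fun t ht => ?_
      have hr := Tree.mem_upTo.1 ht
      have hσ : (1 : ℝ) ≤ t.σ := by exact_mod_cast t.σ_pos
      have hD : ‖t.D W y₀‖ ≤ M ^ t.r := norm_D_le hW t (by omega) y₀
      rw [norm_smul, norm_mul, Real.norm_eq_abs, Real.norm_eq_abs, abs_div,
        abs_of_nonneg (pow_nonneg hs _), abs_of_nonneg (zero_le_one.trans hσ)]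
      have hdiv : s ^ t.r / (t.σ : ℝ) ≤ s ^ t.r := div_le_self (pow_nonneg hs _) hσ
      calc _ ≤ s ^ t.r * |∑ i, b i * stageWeight A t i| * M ^ t.r := by gcongr
        _ = |∑ i, b i * stageWeight A t i| * (s * M) ^ t.r := by rw [mul_pow]; ring
        _ ≤ _ := mul_le_mul_of_nonneg_left (pow_le_pow_right₀ h1 (by omega)) (abs_nonneg _)
    refine (norm_sub_le _ _).trans ((add_le_add e1 e2).trans ?_)
    rw [← add_mul]
    refine mul_le_mul_of_nonneg_right ?_ hpow
    have := mul_nonneg hβ0 hC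
    linarith

end Stages

end RKTree

end

theorem mainTheorem6 (m : ℕ) :
    (∃ C : ℝ, 0 < C ∧ ∀ (N : ℕ) (W : EuclideanSpace ℝ (Fin N) → EuclideanSpace ℝ (Fin N)),
      RKTree.CbSmooth W → ∀ (y₀ : EuclideanSpace ℝ (Fin N)) (s : ℝ), 0 ≤ s →
        ‖RKTree.flow (s • W) y₀ -
            (y₀ + ∑ t ∈ RKTree.Tree.upTo m,
              (s ^ t.r / (t.r.factorial : ℝ) * (t.α : ℝ)) • RKTree.Tree.D W t y₀)‖
          ≤ C * s ^ (m + 1) * RKTree.cNorm (m + 1) W ^ (m + 1)) ∧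
    (∀ (K : ℕ) (A : Matrix (Fin K) (Fin K) ℝ) (b : Fin K → ℝ),
      ∃ C' : ℝ, 0 < C' ∧ ∀ (N : ℕ) (W : EuclideanSpace ℝ (Fin N) → EuclideanSpace ℝ (Fin N)),
        RKTree.CbSmooth W → ∀ (y₀ : EuclideanSpace ℝ (Fin N)) (s : ℝ), 0 ≤ s →
          ∀ Y : Fin K → EuclideanSpace ℝ (Fin N), RKTree.IsStages A W y₀ s Y →
            ‖RKTree.rkOutput b W y₀ s Y -
                (y₀ + ∑ t ∈ RKTree.Tree.upTo m,
                  (s ^ t.r / (t.σ : ℝ) *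
                    ∑ i, b i * (t.branches.map fun t' => RKTree.Tree.ζ A t' i).prod) •
                      RKTree.Tree.D W t y₀)‖
              ≤ C' * s ^ (m + 1) * RKTree.cNorm (m + 1) W ^ (m + 1)) := by
  exact ⟨RKTree.flow_expansion m, fun K A b => RKTree.rkOutput_expansion A m b⟩
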